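/- A lattice $d$-polytope is a $d$-dimensional polytope $P\subset\mathbb R^d$ whose vertices lie in $\mathbb Z^d$. Two such polytopes $P,P'\subset\mathbb R^d$ are integrally equivalent if some affine bijection of $\mathbb R^d$ maps $\mathbb Z^d$ bijectively onto $\mathbb Z^d$ and $P$ onto $P'$. For a vertex $u$ of $P$, the normal cone of $P$ at $u$ is $$\sigma(P,u)=\{y\in(\mathbb R^d)^* : \langle y,x-u\rangle\ge 0\ \text{for all } x\in P\},$$ a pointed rational $d$-dimensional cone. Let $v_1,\dots,v_r$ be its primitive generators, that is, the primitive vectors of the dual lattice $(\mathbb Z^d)^*$ that span its extreme rays. The cone is called $\mathbb Q$-Gorenstein if there is a linear functional taking the value $1$ on all $v_i$, and its multiplicity is the normalized volume ($d!$ times the Euclidean volume) of its nib $\operatorname{conv}(0,v_1,\dots,v_r)$. Let $d$, $m$ and $N$ be nonnegative integers. Then, up to integral equivalence, there are only finitely many lattice $d$-polytopes with exactly $N+1$ lattice points such that the normal cone at every vertex is $\mathbb Q$-Gorenstein of multiplicity at most $m$. -/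

import Mathlib

open scoped Nat ENNReal

noncomputable section

namespace LatticePoly

/-- The real vector of an integer vector. -/
def toReal {d : ℕ} (z : Fin d → ℤ) : Fin d → ℝ := fun i => (z i : ℝ)

/-- The lattice `ℤ^d` inside `ℝ^d`. -/
def intLattice (d : ℕ) : Set (Fin d → ℝ) := Set.range (toReal (d := d))

/-- A lattice polytope in `ℝ^d`: the convex hull of finitely many points of `ℤ^d`. -/
def IsLatticePolytope {d : ℕ} (P : Set (Fin d → ℝ)) : Prop :=
  ∃ V : Finset (Fin d → ℤ), P = convexHull ℝ (toReal '' (V : Set (Fin d → ℤ)))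

/-- Integral equivalence of `P ⊆ ℝ^d` and `P' ⊆ ℝ^d'`: an affine map `aff P → aff P'` carries
`ℤ^d ∩ aff P` bijectively onto `ℤ^d' ∩ aff P'` and maps `P` onto `P'`. (An affine map on `aff P` is
the restriction of an affine map on the whole space.) -/
def IntegrallyEquivalent {d d' : ℕ} (P : Set (Fin d → ℝ)) (P' : Set (Fin d' → ℝ)) : Prop :=
  ∃ f : (Fin d → ℝ) →ᵃ[ℝ] (Fin d' → ℝ),
    Set.BijOn f (intLattice d ∩ (affineSpan ℝ P : Set (Fin d → ℝ)))
      (intLattice d' ∩ (affineSpan ℝ P' : Set (Fin d' → ℝ))) ∧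
    f '' P = P'

/-- The tangent cone `T_u P = cone (u' - u | u' ∈ P)`. -/
def tangentCone {d : ℕ} (P : Set (Fin d → ℝ)) (u : Fin d → ℝ) : PointedCone ℝ (Fin d → ℝ) :=
  PointedCone.hull ℝ ((fun x => x - u) '' P)

/-- The normal cone `σ(P, u)`: the dual of the tangent cone. The dual space of `ℝ^d`, with the
lattice dual to `ℤ^d`, is identified with `ℝ^d` and `ℤ^d` through the dot product. -/
def normalCone {d : ℕ} (P : Set (Fin d → ℝ)) (u : Fin d → ℝ) : PointedCone ℝ (Fin d → ℝ) :=
  PointedCone.dual (dotProductBilin ℝ ℝ) (tangentCone P u : Set (Fin d → ℝ))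

/-- The primitive generators of a cone `σ`: the primitive vectors of `ℤ^d` that span an extreme
ray (a one-dimensional face) of `σ`. -/
def primitiveGenerators {d : ℕ} (σ : PointedCone ℝ (Fin d → ℝ)) : Set (Fin d → ℝ) :=
  {x | ∃ v : Fin d → ℤ, toReal v = x ∧ Finset.univ.gcd v = 1 ∧
    (PointedCone.hull ℝ {x}).IsFaceOf σ}

/-- `σ` is `ℚ`-Gorenstein: its primitive generators lie in an affine hyperplane of the form
`{x | h x = 1}`; the functional `h` is the height of `σ`. -/
def IsQGorenstein {d : ℕ} (σ : PointedCone ℝ (Fin d → ℝ)) : Prop :=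
  ∃ h : Module.Dual ℝ (Fin d → ℝ), ∀ v ∈ primitiveGenerators σ, h v = 1

/-- The nib of `σ`: the convex hull of `0` and the primitive generators. -/
def nib {d : ℕ} (σ : PointedCone ℝ (Fin d → ℝ)) : Set (Fin d → ℝ) :=
  convexHull ℝ (insert 0 (primitiveGenerators σ))

/-- The multiplicity of a `d`-dimensional cone `σ` in `ℝ^d`: the normalized volume of its nib,
that is, `d!` times the Lebesgue measure. -/
def multiplicity {d : ℕ} (σ : PointedCone ℝ (Fin d → ℝ)) : ℝ≥0∞ :=
  (d ! : ℝ≥0∞) * MeasureTheory.volume (nib σ)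

/-- The lattice `d`-polytopes `P ⊆ ℝ^d` with `N + 1` lattice points whose normal cones
at the vertices are `ℚ`-Gorenstein of multiplicity at most `m`. -/
def boundedGorensteinPolytopes (d m N : ℕ) : Set (Set (Fin d → ℝ)) :=
  {P | IsLatticePolytope P ∧ affineSpan ℝ P = ⊤ ∧ (P ∩ intLattice d).ncard = N + 1 ∧
    ∀ u ∈ Set.extremePoints ℝ P,
      IsQGorenstein (normalCone P u) ∧ multiplicity (normalCone P u) ≤ (m : ℝ≥0∞)}

end LatticePoly

end

/-!
A bound on the multiplicity of the normal cones bounds the volumes of their nibs, hence all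
determinants of `d` primitive facet normals at a vertex. Since a tangent cone is dual to a normal
cone, the determinants of `d` primitive edge vectors at a vertex are bounded as well.

Fix a vertex `u₀` and use a basis of primitive edge vectors at `u₀` as coordinates. If `w` points
along an edge from `u` to `u + l • w` and `e`, `e'` are the primitive vectors of the other edges
of a common `2`-face at the two ends, then `e' = a • e + μ • w`, and counting the lattice points
of that face bounds `a` and `μ`. The vectors `e'` and `w` span, so by Cramer's rule the
coordinates of all edge vectors at `u + l • w` are bounded in terms of those at `u`. The number of
vertices is bounded, so every vertex is reached from `u₀` in a bounded number of such steps, and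
`P` lies in a bounded region. In these coordinates `ℤ^d` becomes a lattice containing `ℤ^d` with
bounded denominators, so only finitely many pairs of a lattice and a set of lattice points remain,
and such a pair determines `P` up to integral equivalence.
-/

namespace LatticePoly

variable {d : ℕ}

local notation "dualCone" => PointedCone.dual (dotProductBilin ℝ ℝ)

section Cones

variable {𝕜 E : Type*} [Field 𝕜] [LinearOrder 𝕜] [AddCommGroup E] [Module 𝕜 E]

/-- The generators produced by eliminating the inequality `0 ≤ f` from the cone generated by `G`
(Fourier-Motzkin elimination): those satisfying it, and for every pair on opposite sides of the
hyperplane `f = 0` their positive combination lying on it. -/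
def fourierMotzkin (f : E →ₗ[𝕜] 𝕜) (G : Set E) : Set E :=
  {g ∈ G | 0 ≤ f g} ∪
    (fun p : E × E => f p.1 • p.2 - f p.2 • p.1) '' ({g ∈ G | 0 ≤ f g} ×ˢ {g ∈ G | f g < 0})

theorem finite_fourierMotzkin {f : E →ₗ[𝕜] 𝕜} {G : Set E} (hG : G.Finite) :
    (fourierMotzkin f G).Finite :=
  (hG.sep _).union (((hG.sep _).prod (hG.sep _)).image _)

variable [IsStrictOrderedRing 𝕜]

theorem mem_hull_singleton {v x : E} :
    x ∈ PointedCone.hull 𝕜 {v} ↔ ∃ c : 𝕜, 0 ≤ c ∧ c • v = x := by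
  rw [Submodule.mem_span_singleton]
  exact ⟨fun ⟨c, hc⟩ => ⟨c, c.2, hc⟩, fun ⟨c, hc₀, hc⟩ => ⟨⟨c, hc₀⟩, hc⟩⟩

theorem mem_hull_singleton_self (v : E) : v ∈ PointedCone.hull 𝕜 {v} :=
  PointedCone.subset_hull (Set.mem_singleton v)

theorem mem_of_isFaceOf_hull_singleton {C : PointedCone 𝕜 E} {v : E}
    (hv : (PointedCone.hull 𝕜 {v}).IsFaceOf C) : v ∈ C :=
  hv.le (mem_hull_singleton_self v)

theorem mem_hull_singleton_of_add_mem_span {C : PointedCone 𝕜 E} {v x y : E}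
    (hv : (PointedCone.hull 𝕜 {v}).IsFaceOf C) (hx : x ∈ C) (hy : y ∈ C)
    (hxy : x + y ∈ Submodule.span 𝕜 {v}) : x ∈ PointedCone.hull 𝕜 {v} := by
  obtain ⟨c, hc⟩ := Submodule.mem_span_singleton.1 hxy
  refine hv.mem_of_add_mem_left hx
    (add_mem hy (PointedCone.smul_mem _ (abs_nonneg c) (mem_of_isFaceOf_hull_singleton hv))) ?_
  rw [← add_assoc, ← hc, ← add_smul]
  exact PointedCone.smul_mem _ (by linarith [neg_abs_le c]) (mem_hull_singleton_self v)

theorem exists_pos_smul_mem_of_isFaceOf_hull {G : Set E} {v : E} (hv₀ : v ≠ 0)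
    (hv : (PointedCone.hull 𝕜 {v}).IsFaceOf (PointedCone.hull 𝕜 G)) :
    ∃ a : 𝕜, 0 < a ∧ a • v ∈ G := by
  classical
  obtain ⟨c, hc, hc₀, hsum : ∑ x ∈ c.support, c x • x = v⟩ :=
    PointedCone.mem_hull_set.1 (mem_of_isFaceOf_hull_singleton hv)
  obtain ⟨g, hg, hcg : c g • g ≠ 0⟩ := Finset.exists_ne_zero_of_sum_ne_zero (hsum.trans_ne hv₀)
  have hmem : ∀ x ∈ c.support, c x • x ∈ PointedCone.hull 𝕜 G := fun x hx =>
    PointedCone.smul_mem _ (hc₀ x) (PointedCone.subset_hull (hc hx))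
  have hface : c g • g ∈ PointedCone.hull 𝕜 {v} := by
    refine hv.mem_of_add_mem_left (y := ∑ x ∈ c.support.erase g, c x • x) (hmem g hg)
      (sum_mem fun x hx => hmem x (Finset.mem_of_mem_erase hx)) ?_
    rw [Finset.add_sum_erase _ (fun x => c x • x) hg, hsum]
    exact mem_hull_singleton_self v
  obtain ⟨b, hb, hbv⟩ := mem_hull_singleton.1 hface
  have hb₀ : b ≠ 0 := fun h => hcg (by rw [← hbv, h, zero_smul])
  have hcg₀ : c g ≠ 0 := Finsupp.mem_support_iff.1 hg
  refine ⟨(c g)⁻¹ * b, mul_pos (inv_pos.2 ((hc₀ g).lt_of_ne' hcg₀)) (hb.lt_of_ne' hb₀), ?_⟩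
  rw [mul_smul, hbv, inv_smul_smul₀ hcg₀]
  exact hc hg

theorem isFaceOf_hull_of_notMem_hull_sdiff {G : Set E} {g : E}
    (hG : (PointedCone.hull 𝕜 G : ConvexCone 𝕜 E).Salient) (hg : g ∈ G)
    (hgG : g ∉ PointedCone.hull 𝕜 (G \ {g})) :
    (PointedCone.hull 𝕜 {g}).IsFaceOf (PointedCone.hull 𝕜 G) := by
  have hle : PointedCone.hull 𝕜 (G \ {g}) ≤ PointedCone.hull 𝕜 G :=
    Submodule.span_mono Set.sdiff_subset
  have hgmem : g ∈ PointedCone.hull 𝕜 G := PointedCone.subset_hull hg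
  have hdecomp : ∀ x ∈ PointedCone.hull 𝕜 G,
      ∃ a : 𝕜, 0 ≤ a ∧ ∃ z ∈ PointedCone.hull 𝕜 (G \ {g}), x = a • g + z := fun x hx => by
    rw [← Set.insert_sdiff_self_of_mem hg, Submodule.mem_span_insert] at hx
    obtain ⟨a, z, hz, rfl⟩ := hx
    exact ⟨a, a.2, z, hz, rfl⟩
  refine .of_mem_of_add_mem_left (Submodule.span_mono (Set.singleton_subset_iff.2 hg))
    fun {x y} hx hy hxy => ?_
  obtain ⟨a, ha, x', hx', rfl⟩ := hdecomp x hx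
  obtain ⟨b, -, y', hy', rfl⟩ := hdecomp y hy
  obtain ⟨c, -, hc⟩ := mem_hull_singleton.1 hxy
  have hsum : (c - a - b) • g = x' + y' := by
    rw [sub_smul, sub_smul, hc]
    abel
  have hnonpos : c - a - b ≤ 0 := by
    by_contra! hpos
    exact hgG ((inv_smul_smul₀ hpos.ne' g).subst (motive := (· ∈ PointedCone.hull 𝕜 (G \ {g})))
      (hsum ▸ PointedCone.smul_mem _ (inv_nonneg.2 hpos.le) (add_mem hx' hy')))
  have hx'₀ : x' = 0 := by
    by_contra hne
    refine hG x' (hle hx') hne ?_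
    have hneg : -x' = y' + -(c - a - b) • g := by
      rw [neg_smul, hsum]
      abel
    rw [hneg]
    exact add_mem (hle hy') (PointedCone.smul_mem _ (neg_nonneg.2 hnonpos) hgmem)
  rw [hx'₀, add_zero]
  exact PointedCone.smul_mem _ ha (mem_hull_singleton_self g)

theorem hull_setOf_isFaceOf_hull {G : Set E} (hfin : G.Finite)
    (hG : (PointedCone.hull 𝕜 G : ConvexCone 𝕜 E).Salient) :
    PointedCone.hull 𝕜 {g ∈ G | g ≠ 0 ∧ (PointedCone.hull 𝕜 {g}).IsFaceOf (PointedCone.hull 𝕜 G)} =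
      PointedCone.hull 𝕜 G := by
  obtain ⟨I, hIG, ⟨-, hI⟩, hmin⟩ := (hfin.finite_subsets.subset (Set.sep_subset _
    fun I => PointedCone.hull 𝕜 I = PointedCone.hull 𝕜 G)).exists_le_minimal ⟨Set.Subset.rfl, rfl⟩
  refine le_antisymm (Submodule.span_mono (Set.sep_subset _ _)) ?_
  refine hI.ge.trans (Submodule.span_mono fun g hg => ?_)
  have hgI : g ∉ PointedCone.hull 𝕜 (I \ {g}) := fun h => by
    refine (hmin (y := I \ {g}) ⟨Set.sdiff_subset.trans hIG, ?_⟩ Set.sdiff_subset hg).2 rfl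
    rw [← hI, PointedCone.hull, ← Submodule.span_insert_eq_span h, Set.insert_sdiff_self_of_mem hg]
  refine ⟨hIG hg, fun h => hgI (h ▸ zero_mem _), ?_⟩
  exact hI ▸ isFaceOf_hull_of_notMem_hull_sdiff (hI ▸ hG) hg hgI

theorem dual_fourierMotzkin {F : Type*} [AddCommGroup F] [Module 𝕜 F] (p : E →ₗ[𝕜] F →ₗ[𝕜] 𝕜)
    {G : Set E} (hG : G.Finite) (z : F) :
    PointedCone.dual p (fourierMotzkin (p.flip z) G) =
      PointedCone.hull 𝕜 (insert z (PointedCone.dual p G : Set F)) := by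
  refine le_antisymm (fun x hx => ?_) (Submodule.span_le.2 (Set.insert_subset ?_ ?_))
  · obtain ⟨t, ht₀, ht⟩ : ∃ t : 𝕜, 0 ≤ t ∧ ∀ g ∈ G, t * p g z ≤ p g x := by
      obtain ⟨t, ht, htmax⟩ := Set.exists_max_image
        (insert 0 ((fun g => p g x / p g z) '' {g ∈ G | p g z < 0})) id
        (((hG.sep _).image _).insert 0) (Set.insert_nonempty _ _)
      refine ⟨t, htmax 0 (Set.mem_insert _ _), fun g hg => ?_⟩
      rcases lt_or_ge (p g z) 0 with hgz | hgz
      · exact (div_le_iff_of_neg hgz).1 (htmax _ (.inr ⟨g, ⟨hg, hgz⟩, rfl⟩))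
      · rcases ht with rfl | ⟨h, ⟨hh, hhz⟩, rfl⟩
        · simpa using hx (.inl ⟨hg, hgz⟩)
        · have hgh : p h z * p g x ≤ p g z * p h x := by
            simpa using hx (.inr ⟨(g, h), ⟨⟨hg, hgz⟩, hh, hhz⟩, rfl⟩)
          change p h x / p h z * p g z ≤ p g x
          rw [div_mul_eq_mul_div, div_le_iff_of_neg hhz]
          linarith
    rw [← add_sub_cancel (t • z) x]
    refine add_mem (PointedCone.smul_mem _ ht₀ (PointedCone.subset_hull (.inl rfl)))
      (PointedCone.subset_hull (.inr fun g hg => ?_))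
    simpa using ht g hg
  · rintro _ (⟨_, hgz⟩ | ⟨⟨g, h⟩, -, rfl⟩)
    · exact hgz
    · simp [mul_comm]
  · rintro y hy _ (⟨hg, _⟩ | ⟨⟨g, h⟩, ⟨⟨hg, hgz⟩, hh, hhz⟩, rfl⟩)
    · exact hy hg
    · simpa using (mul_nonpos_of_nonpos_of_nonneg hhz.le (hy hg)).trans
        (mul_nonneg hgz (hy hh))

theorem hull_singleton_smul {c : 𝕜} (hc : 0 < c) (v : E) :
    PointedCone.hull 𝕜 {c • v} = PointedCone.hull 𝕜 {v} :=
  Submodule.span_singleton_smul_eq (r := (⟨c, hc.le⟩ : {c : 𝕜 // 0 ≤ c}))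
    (Subtype.coe_ne_coe.1 hc.ne').isUnit v

theorem exists_pos_add_smul_mem_dual {F : Type*} [AddCommGroup F] [Module 𝕜 F]
    (p : E →ₗ[𝕜] F →ₗ[𝕜] 𝕜) {G : Set E} (hG : G.Finite) {w q : F} (hw : w ∈ PointedCone.dual p G)
    (hq : ∀ g ∈ G, p g w = 0 → p g q = 0) :
    ∃ ε : 𝕜, 0 < ε ∧ w + ε • q ∈ PointedCone.dual p G ∧ w - ε • q ∈ PointedCone.dual p G := by
  obtain ⟨t, ht⟩ := (hG.image fun g => |p g q| / p g w).bddAbove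
  have hpos : 0 < max t 1 := zero_lt_one.trans_le (le_max_right _ _)
  have hle : ∀ g ∈ G, (max t 1)⁻¹ * |p g q| ≤ p g w := fun g hg => by
    rw [inv_mul_le_iff₀ hpos]
    rcases (hw hg).eq_or_lt' with h | h
    · simp [h, hq g hg h]
    · exact (div_le_iff₀ h).1 ((ht ⟨g, hg, rfl⟩).trans (le_max_left _ _))
  have habs : ∀ g ∈ G, |(max t 1)⁻¹ * p g q| ≤ p g w := fun g hg => by
    rw [abs_mul, abs_of_pos (inv_pos.2 hpos)]
    exact hle g hg
  refine ⟨(max t 1)⁻¹, inv_pos.2 hpos, fun g hg => ?_, fun g hg => ?_⟩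
  · rw [map_add, map_smul, smul_eq_mul]
    linarith [(abs_le.1 (habs g hg)).1]
  · rw [map_sub, map_smul, smul_eq_mul]
    linarith [(abs_le.1 (habs g hg)).2]

theorem mem_span_singleton_of_forall_tight {F : Type*} [AddCommGroup F] [Module 𝕜 F]
    (p : E →ₗ[𝕜] F →ₗ[𝕜] 𝕜) {G : Set E} (hG : G.Finite) {w q : F}
    (hw : (PointedCone.hull 𝕜 {w}).IsFaceOf (PointedCone.dual p G))
    (hq : ∀ g ∈ G, p g w = 0 → p g q = 0) : q ∈ Submodule.span 𝕜 {w} := by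
  obtain ⟨ε, hε, hadd, hsub⟩ :=
    exists_pos_add_smul_mem_dual p hG (mem_of_isFaceOf_hull_singleton hw) hq
  have hwmem := Submodule.mem_span_singleton_self (R := 𝕜) w
  have hmem : w + ε • q ∈ Submodule.span 𝕜 {w} := by
    refine PointedCone.hull_le_span _ _ (mem_hull_singleton_of_add_mem_span hw hadd hsub ?_)
    rw [add_add_sub_cancel]
    exact add_mem hwmem hwmem
  exact (Submodule.smul_mem_iff _ hε.ne').1 ((Submodule.add_mem_iff_right _ hwmem).1 hmem)

end Cones

section Lattice

variable {v x y : Fin d → ℝ}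

theorem mem_intLattice : x ∈ intLattice d ↔ ∀ i, ∃ n : ℤ, (n : ℝ) = x i := by
  rw [Classical.skolem]
  exact exists_congr fun _ => funext_iff

/-- The lattice `ℤ^d` as an additive subgroup of `ℝ^d`; its carrier is `intLattice d`. -/
def intSubgroup (d : ℕ) : AddSubgroup (Fin d → ℝ) where
  carrier := intLattice d
  zero_mem' := ⟨0, funext fun _ => Int.cast_zero⟩
  add_mem' := fun ⟨a, ha⟩ ⟨b, hb⟩ => ⟨a + b, ha ▸ hb ▸ funext fun _ => Int.cast_add _ _⟩
  neg_mem' := fun ⟨a, ha⟩ => ⟨-a, ha ▸ funext fun _ => Int.cast_neg _⟩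

theorem exists_int_cast_eq_dotProduct (hx : x ∈ intLattice d) (hy : y ∈ intLattice d) :
    ∃ n : ℤ, (n : ℝ) = x ⬝ᵥ y := by
  obtain ⟨a, rfl⟩ := hx
  obtain ⟨b, rfl⟩ := hy
  exact ⟨a ⬝ᵥ b, by simp [dotProduct, toReal]⟩

theorem exists_int_cast_eq_det {b : Fin d → Fin d → ℝ} (hb : ∀ i, b i ∈ intLattice d) :
    ∃ n : ℤ, (n : ℝ) = (Matrix.of b).det := by
  choose a ha using hb
  refine ⟨(Matrix.of a).det, ?_⟩
  rw [← eq_intCast (Int.castRingHom ℝ), RingHom.map_det, ← funext ha]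
  rfl

theorem one_le_abs_of_int_cast_eq {t : ℝ} (ht : ∃ n : ℤ, (n : ℝ) = t) (ht₀ : t ≠ 0) : 1 ≤ |t| := by
  obtain ⟨n, rfl⟩ := ht
  exact_mod_cast Int.one_le_abs (by simpa using ht₀)

/-- A primitive vector of `ℤ^d`, seen in `ℝ^d`. -/
def IsPrimitive (x : Fin d → ℝ) : Prop := ∃ v : Fin d → ℤ, toReal v = x ∧ Finset.univ.gcd v = 1

theorem mem_primitiveGenerators {σ : PointedCone ℝ (Fin d → ℝ)} :
    x ∈ primitiveGenerators σ ↔ IsPrimitive x ∧ (PointedCone.hull ℝ {x}).IsFaceOf σ := by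
  simp only [primitiveGenerators, IsPrimitive, Set.mem_ofPred_eq, ← exists_and_right, and_assoc]

theorem IsPrimitive.mem_intLattice (hx : IsPrimitive x) : x ∈ intLattice d :=
  hx.imp fun _ h => h.1

theorem IsPrimitive.neg (hx : IsPrimitive x) : IsPrimitive (-x) := by
  obtain ⟨v, rfl, hv⟩ := hx
  refine ⟨-v, funext fun _ => Int.cast_neg _, ?_⟩
  simpa [hv, Pi.neg_def, show normalize (-1 : ℤ) = 1 from rfl] using
    Finset.gcd_mul_left (s := Finset.univ) (f := v) (a := -1)

theorem IsPrimitive.exists_dotProduct_eq_one (hx : IsPrimitive x) :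
    ∃ g ∈ intLattice d, g ⬝ᵥ x = 1 := by
  obtain ⟨v, rfl, hv⟩ := hx
  obtain ⟨g, hg⟩ := Finset.gcd_eq_sum_mul Finset.univ v
  refine ⟨toReal g, ⟨g, rfl⟩, ?_⟩
  have hvg : ∑ i, v i * g i = 1 := hg.symm.trans hv
  simpa [dotProduct, toReal, mul_comm] using congrArg (Int.cast (R := ℝ)) hvg

theorem IsPrimitive.ne_zero (hx : IsPrimitive x) : x ≠ 0 := by
  rintro rfl
  obtain ⟨g, -, hg⟩ := hx.exists_dotProduct_eq_one
  simp at hg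

theorem IsPrimitive.exists_int_cast_eq (hx : IsPrimitive x) {a : ℝ} (ha : a • x ∈ intLattice d) :
    ∃ n : ℤ, (n : ℝ) = a := by
  obtain ⟨g, hgL, hg⟩ := hx.exists_dotProduct_eq_one
  simpa [hg] using exists_int_cast_eq_dotProduct hgL ha

theorem IsPrimitive.smul_eq_self (hv : IsPrimitive v) {a : ℝ} (ha : 0 < a)
    (hav : IsPrimitive (a • v)) : a • v = v := by
  have hle : 1 ≤ a := by
    simpa only [abs_of_pos ha] using
      one_le_abs_of_int_cast_eq (hv.exists_int_cast_eq hav.mem_intLattice) ha.ne'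
  have hge : 1 ≤ a⁻¹ := by
    simpa only [abs_of_pos (inv_pos.2 ha)] using one_le_abs_of_int_cast_eq
      (hav.exists_int_cast_eq (by simpa only [inv_smul_smul₀ ha.ne'] using hv.mem_intLattice))
      (inv_ne_zero ha.ne')
  rw [((one_le_inv₀ ha).1 hge).antisymm hle, one_smul]

theorem exists_isPrimitive_smul_eq (hx : x ∈ intLattice d) (hx₀ : x ≠ 0) :
    ∃ w, IsPrimitive w ∧ ∃ a : ℝ, 0 < a ∧ a • w = x := by
  obtain ⟨z, rfl⟩ := hx
  obtain ⟨i, hi⟩ := Function.ne_iff.1 hx₀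
  obtain ⟨w, hw, hgcd⟩ := Finset.extract_gcd z ⟨i, Finset.mem_univ i⟩
  have hpos : 0 < Finset.univ.gcd z := by
    refine (Int.nonneg_of_normalize_eq_self Finset.normalize_gcd).lt_of_ne' fun h => hi ?_
    simp [toReal, Finset.gcd_eq_zero_iff.1 h i (Finset.mem_univ i)]
  refine ⟨toReal w, ⟨w, rfl, hgcd⟩, (Finset.univ.gcd z : ℤ), mod_cast hpos, funext fun j => ?_⟩
  simp [toReal, hw j (Finset.mem_univ j)]

theorem finite_primitiveGenerators_hull {G : Set (Fin d → ℝ)} (hG : G.Finite) :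
    (primitiveGenerators (PointedCone.hull ℝ G)).Finite := by
  have hex : ∀ v ∈ primitiveGenerators (PointedCone.hull ℝ G), ∃ a : ℝ, 0 < a ∧ a • v ∈ G :=
    fun v hv => exists_pos_smul_mem_of_isFaceOf_hull (mem_primitiveGenerators.1 hv).1.ne_zero
      (mem_primitiveGenerators.1 hv).2
  choose! a ha haG using hex
  refine Set.Finite.of_finite_image (f := fun v => a v • v) (hG.subset ?_) fun v hv w hw hvw => ?_
  · rintro _ ⟨v, hv, rfl⟩
    exact haG v hv
  · have hvw' : v = ((a v)⁻¹ * a w) • w := by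
      rw [mul_smul, ← show a v • v = a w • w from hvw, inv_smul_smul₀ (ha v hv).ne']
    have hv' := (mem_primitiveGenerators.1 hv).1
    rw [hvw'] at hv' ⊢
    exact (mem_primitiveGenerators.1 hw).1.smul_eq_self
      (mul_pos (inv_pos.2 (ha v hv)) (ha w hw)) hv'

theorem hull_primitiveGenerators {G : Set (Fin d → ℝ)} (hG : G.Finite) (hL : G ⊆ intLattice d)
    (hsal : (PointedCone.hull ℝ G : ConvexCone ℝ (Fin d → ℝ)).Salient) :
    PointedCone.hull ℝ (primitiveGenerators (PointedCone.hull ℝ G)) = PointedCone.hull ℝ G := by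
  refine le_antisymm (Submodule.span_le.2 fun v hv =>
    mem_of_isFaceOf_hull_singleton (mem_primitiveGenerators.1 hv).2) ?_
  refine (hull_setOf_isFaceOf_hull hG hsal).ge.trans (Submodule.span_le.2 ?_)
  rintro g ⟨hg, hg₀, hface⟩
  obtain ⟨w, hw, a, ha, rfl⟩ := exists_isPrimitive_smul_eq (hL hg) hg₀
  rw [hull_singleton_smul ha] at hface
  exact PointedCone.smul_mem _ ha.le
    (PointedCone.subset_hull (mem_primitiveGenerators.2 ⟨hw, hface⟩))

end Lattice

section RationalCones

theorem flip_dotProductBilin :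
    (dotProductBilin ℝ ℝ : (Fin d → ℝ) →ₗ[ℝ] _).flip = dotProductBilin ℝ ℝ :=
  LinearMap.ext₂ fun x y => dotProduct_comm y x

theorem exists_dualCone_eq_bot (d : ℕ) :
    ∃ F ⊆ intLattice d, F.Finite ∧ dualCone F = ⊥ := by
  refine ⟨Set.range (fun i => Pi.single i 1) ∪ Set.range (fun i => -Pi.single i 1), ?_,
    (Set.finite_range _).union (Set.finite_range _), ?_⟩
  · have hmem : ∀ i, Pi.single i 1 ∈ intLattice d := fun i => mem_intLattice.2 fun j =>
      ⟨Pi.single (M := fun _ => ℤ) i 1 j, by obtain rfl | h := eq_or_ne j i <;> simp [*]⟩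
    rintro _ (⟨i, rfl⟩ | ⟨i, rfl⟩)
    exacts [hmem i, (intSubgroup d).neg_mem (hmem i)]
  · refine (Submodule.eq_bot_iff _).2 fun x hx => funext fun i => le_antisymm ?_ ?_
    · simpa using hx (.inr ⟨i, rfl⟩)
    · simpa using hx (.inl ⟨i, rfl⟩)

theorem exists_dualCone_eq_hull {G : Set (Fin d → ℝ)} (hG : G.Finite) (hL : G ⊆ intLattice d) :
    ∃ F ⊆ intLattice d, F.Finite ∧ dualCone F = PointedCone.hull ℝ G := by
  induction G, hG using Set.Finite.induction_on with
  | empty => simpa using exists_dualCone_eq_bot d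
  | @insert z G _ _ ih =>
    obtain ⟨F, hF, hfin, hdual⟩ := ih ((Set.subset_insert _ _).trans hL)
    refine ⟨fourierMotzkin ((dotProductBilin ℝ ℝ).flip z) F, ?_, finite_fourierMotzkin hfin, ?_⟩
    · have hsmul : ∀ {f h}, f ∈ F → h ∈ F → (f ⬝ᵥ z) • h ∈ intLattice d := fun hf hh => by
        obtain ⟨n, hn⟩ := exists_int_cast_eq_dotProduct (hF hf) (hL (Set.mem_insert z G))
        rw [← hn, Int.cast_smul_eq_zsmul]
        exact (intSubgroup d).zsmul_mem (hF hh) n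
      rintro _ (hf | ⟨⟨f, h⟩, ⟨hf, hh⟩, rfl⟩)
      · exact hF hf.1
      · exact (intSubgroup d).sub_mem (hsmul hf.1 hh.1) (hsmul hh.1 hf.1)
    · rw [dual_fourierMotzkin _ hfin, hdual]
      simp only [PointedCone.hull, Submodule.span_insert, Submodule.span_span]

theorem dualCone_dualCone {G : Set (Fin d → ℝ)} (hG : G.Finite) (hL : G ⊆ intLattice d) :
    dualCone (dualCone G : Set (Fin d → ℝ)) = PointedCone.hull ℝ G := by
  obtain ⟨F, -, -, hF⟩ := exists_dualCone_eq_hull hG hL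
  have htriple := PointedCone.dual_dual_flip_dual (p := dotProductBilin ℝ ℝ) F
  rwa [flip_dotProductBilin, hF, PointedCone.dual_hull] at htriple

theorem exists_hull_eq_dualCone {G : Set (Fin d → ℝ)} (hG : G.Finite) (hL : G ⊆ intLattice d) :
    ∃ F ⊆ intLattice d, F.Finite ∧ PointedCone.hull ℝ F = dualCone G := by
  obtain ⟨F, hFL, hfin, hF⟩ := exists_dualCone_eq_hull hG hL
  refine ⟨F, hFL, hfin, ?_⟩
  rw [← dualCone_dualCone hfin hFL, hF, PointedCone.dual_hull]

end RationalCones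

section Determinants

/-- All determinants of `d` vectors of `E ⊆ ℝ^d` are at most `K` in absolute value. -/
def DetBoundedBy (E : Set (Fin d → ℝ)) (K : ℝ) : Prop :=
  ∀ b : Fin d → Fin d → ℝ, (∀ i, b i ∈ E) → |(Matrix.of b).det| ≤ K

theorem sum_det_update_smul (b : Fin d → Fin d → ℝ) (x : Fin d → ℝ) :
    ∑ i, (Matrix.of (Function.update b i x)).det • b i = (Matrix.of b).det • x := by
  rw [← Matrix.det_transpose, ← Matrix.mulVec_cramer]
  ext j
  simp only [Finset.sum_apply, Pi.smul_apply, smul_eq_mul, Matrix.mulVec, dotProduct,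
    Matrix.cramer_transpose_apply, Matrix.transpose_apply, Matrix.of_apply, mul_comm]
  rfl

theorem exists_det_ne_zero_of_span_eq_top {E : Set (Fin d → ℝ)} (hE : Submodule.span ℝ E = ⊤) :
    ∃ b : Fin d → Fin d → ℝ, (∀ i, b i ∈ E) ∧ (Matrix.of b).det ≠ 0 := by
  obtain ⟨f, hf, -, hli⟩ := Submodule.exists_fun_fin_finrank_span_eq ℝ E
  have hfr : Module.finrank ℝ (Submodule.span ℝ E) = d := by
    rw [hE, finrank_top, Module.finrank_fin_fun]
  refine ⟨fun i => f (Fin.cast hfr.symm i), fun i => hf _, ?_⟩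
  rw [← isUnit_iff_ne_zero, ← Matrix.isUnit_iff_isUnit_det,
    ← Matrix.linearIndependent_rows_iff_isUnit]
  exact hli.comp _ (Fin.cast_injective _)

theorem DetBoundedBy.nonneg {E : Set (Fin d → ℝ)} {K : ℝ} (hK : DetBoundedBy E K)
    (hE : Submodule.span ℝ E = ⊤) : 0 ≤ K := by
  obtain ⟨b, hb, -⟩ := exists_det_ne_zero_of_span_eq_top hE
  exact (abs_nonneg _).trans (hK b hb)

theorem span_eq_top_of_forall_dotProduct_eq_zero {E : Set (Fin d → ℝ)}
    (hE : ∀ x, (∀ v ∈ E, v ⬝ᵥ x = 0) → x = 0) : Submodule.span ℝ E = ⊤ := by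
  by_contra hne
  obtain ⟨f, hf, hle⟩ := Submodule.exists_le_ker_of_lt_top _ (lt_top_iff_ne_top.2 hne)
  obtain ⟨x, rfl⟩ := (dotProductEquiv ℝ (Fin d)).surjective f
  refine hf ?_
  rw [hE x fun v hv => ?_, map_zero]
  simpa [dotProduct_comm] using hle (Submodule.subset_span hv)

theorem IsPrimitive.exists_int_cast_mul_dotProduct_eq_det {v w : Fin d → ℝ} (hw : IsPrimitive w)
    {b : Fin d → Fin d → ℝ} (hb : ∀ i, b i ∈ intLattice d)
    (hbw : ∀ i, b i = v ∨ b i ⬝ᵥ w = 0) : ∃ k : ℤ, (k : ℝ) * v ⬝ᵥ w = (Matrix.of b).det := by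
  obtain ⟨g, hg, hgw⟩ := hw.exists_dotProduct_eq_one
  have hterm : ∀ i, ∃ k : ℤ, (k : ℝ) * v ⬝ᵥ w =
      (Matrix.of (Function.update b i g)).det * b i ⬝ᵥ w := fun i => by
    rcases hbw i with rfl | h
    · obtain ⟨k, hk⟩ := exists_int_cast_eq_det (b := Function.update b i g) fun j => by
        rw [Function.update_apply]
        split_ifs
        exacts [hg, hb j]
      exact ⟨k, by rw [hk]⟩
    · exact ⟨0, by rw [h, Int.cast_zero, zero_mul, mul_zero]⟩
  choose k hk using hterm
  refine ⟨∑ i, k i, ?_⟩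
  rw [Int.cast_sum, Finset.sum_mul, Finset.sum_congr rfl fun i _ => hk i]
  simpa [sum_dotProduct, hgw] using congrArg (· ⬝ᵥ w) (sum_det_update_smul b g)

theorem DetBoundedBy.abs_dotProduct_le {F : Set (Fin d → ℝ)} {K : ℝ} (hK : DetBoundedBy F K)
    (hfin : F.Finite) (hF : F ⊆ intLattice d) {v w : Fin d → ℝ}
    (hw : w ∈ primitiveGenerators (dualCone F)) (hv : v ∈ F) : |v ⬝ᵥ w| ≤ K := by
  obtain ⟨hprim, hface⟩ := mem_primitiveGenerators.1 hw
  obtain hvw | hvw := eq_or_ne (v ⬝ᵥ w) 0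
  · rw [hvw, abs_zero]
    exact (abs_nonneg _).trans (hK (fun _ => v) fun _ => hv)
  have hspan : Submodule.span ℝ (insert v {z ∈ F | z ⬝ᵥ w = 0}) = ⊤ := by
    refine span_eq_top_of_forall_dotProduct_eq_zero fun x hx => ?_
    obtain ⟨a, rfl⟩ := Submodule.mem_span_singleton.1
      (mem_span_singleton_of_forall_tight _ hfin hface fun z hz hzw => hx z (.inr ⟨hz, hzw⟩))
    have ha : a * v ⬝ᵥ w = 0 := by simpa using hx v (.inl rfl)
    rw [(mul_eq_zero.1 ha).resolve_right hvw, zero_smul]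
  obtain ⟨b, hb, hdet⟩ := exists_det_ne_zero_of_span_eq_top hspan
  have hbF : ∀ i, b i ∈ F := fun i => (hb i).elim (fun h => h ▸ hv) And.left
  obtain ⟨k, hk⟩ := hprim.exists_int_cast_mul_dotProduct_eq_det (fun i => hF (hbF i))
    fun i => (hb i).imp_right And.right
  have hk₀ : (k : ℝ) ≠ 0 := fun h => hdet (by rw [← hk, h, zero_mul])
  refine le_trans ?_ (hK b hbF)
  rw [← hk, abs_mul]
  exact le_mul_of_one_le_left (abs_nonneg _) (one_le_abs_of_int_cast_eq ⟨k, rfl⟩ hk₀)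

theorem DetBoundedBy.primitiveGenerators_dualCone {F : Set (Fin d → ℝ)} (hfin : F.Finite)
    (hF : F ⊆ intLattice d) (hspan : Submodule.span ℝ F = ⊤) {K : ℝ} (hK : DetBoundedBy F K) :
    DetBoundedBy (primitiveGenerators (dualCone F)) (d ! * K ^ d) := by
  intro w hw
  obtain ⟨v, hv, hdet⟩ := exists_det_ne_zero_of_span_eq_top hspan
  have hentry : ∀ i j, |(Matrix.of v * (Matrix.of w).transpose) i j| ≤ K :=
    fun i j => hK.abs_dotProduct_le hfin hF (hw j) (hv i)
  have hprod : |(Matrix.of v * (Matrix.of w).transpose).det| ≤ d ! * K ^ d := by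
    simpa using Matrix.det_le (abv := AbsoluteValue.abs) hentry
  rw [Matrix.det_mul, Matrix.det_transpose, abs_mul] at hprod
  exact (le_mul_of_one_le_left (abs_nonneg _) (one_le_abs_of_int_cast_eq
    (exists_int_cast_eq_det fun i => hF (hv i)) hdet)).trans hprod

open scoped Pointwise in
theorem parallelepiped_subset_smul_convexHull (b : Fin d → Fin d → ℝ) :
    parallelepiped b ⊆ (d : ℝ) • convexHull ℝ (insert 0 (Set.range b)) := by
  intro x hx
  obtain ⟨t, ht, rfl⟩ := (mem_parallelepiped_iff _ _).1 hx
  have hC := convex_convexHull ℝ (insert 0 (Set.range b))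
  have hmem : ∀ y ∈ insert 0 (Set.range b), y ∈ convexHull ℝ (insert 0 (Set.range b)) :=
    fun y hy => subset_convexHull ℝ _ hy
  obtain rfl | hd := Nat.eq_zero_or_pos d
  · simp
  have hd' : (d : ℝ) ≠ 0 := mod_cast hd.ne'
  refine ⟨∑ i, (d : ℝ)⁻¹ • t i • b i, hC.sum_mem (fun _ _ => by positivity) (by simp [hd'])
    fun i _ => hC.smul_mem_of_zero_mem (hmem 0 (.inl rfl)) (hmem _ (.inr ⟨i, rfl⟩))
      ⟨ht.1 i, ht.2 i⟩, ?_⟩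
  change (d : ℝ) • _ = _
  rw [← Finset.smul_sum, smul_inv_smul₀ hd']

open scoped Pointwise in
theorem ofReal_abs_det_le_volume (b : Fin d → Fin d → ℝ) :
    ENNReal.ofReal |(Matrix.of b).det| ≤
      d ^ d * MeasureTheory.volume (convexHull ℝ (insert 0 (Set.range b))) := by
  have hvol : MeasureTheory.volume (parallelepiped b) = ENNReal.ofReal |(Matrix.of b).det| := by
    have h := MeasureTheory.Measure.addHaar_parallelepiped (Pi.basisFun ℝ (Fin d)) b
    rwa [Module.Basis.addHaar_def, Module.Basis.parallelepiped_basisFun,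
      MeasureTheory.addHaarMeasure_eq_volume_pi, Module.Basis.det_apply,
      ← Matrix.det_transpose] at h
  rw [← hvol]
  refine (MeasureTheory.measure_mono (parallelepiped_subset_smul_convexHull b)).trans_eq ?_
  rw [MeasureTheory.Measure.addHaar_smul_of_nonneg _ (Nat.cast_nonneg d), Module.finrank_fin_fun,
    ENNReal.ofReal_pow (Nat.cast_nonneg d), ENNReal.ofReal_natCast]

theorem detBoundedBy_of_multiplicity_le {σ : PointedCone ℝ (Fin d → ℝ)} {m : ℕ}
    (hm : multiplicity σ ≤ m) : DetBoundedBy (primitiveGenerators σ) (d ^ d * m) := by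
  intro b hb
  have hvol : MeasureTheory.volume (convexHull ℝ (insert 0 (Set.range b))) ≤ m := by
    refine ((MeasureTheory.measure_mono (convexHull_mono (Set.insert_subset_insert
      (Set.range_subset_iff.2 hb)))).trans ?_).trans hm
    exact le_mul_of_one_le_left zero_le (mod_cast (Nat.factorial_pos d : 1 ≤ d !))
  refine (ENNReal.ofReal_le_ofReal_iff (by positivity)).1 ((ofReal_abs_det_le_volume b).trans ?_)
  simpa [ENNReal.ofReal_mul, ENNReal.ofReal_pow] using mul_le_mul_right hvol _

end Determinants

section TangentCone

variable {P : Set (Fin d → ℝ)} {u w x : Fin d → ℝ} {l : ℝ}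

open scoped Pointwise in
theorem mem_tangentCone (hP : Convex ℝ P) (hu : u ∈ P) :
    x ∈ tangentCone P u ↔ ∃ ε : ℝ, 0 < ε ∧ u + ε • x ∈ P := by
  have hconv : Convex ℝ ((fun y => y - u) '' P) := by
    simpa only [sub_eq_add_neg, add_comm] using hP.translate (-u)
  have hsub := ConvexCone.subset_hull (R := ℝ) (s := (fun y => y - u) '' P)
  have hpointed : (ConvexCone.hull ℝ ((fun y => y - u) '' P)).Pointed :=
    hsub ⟨u, hu, sub_self u⟩
  constructor
  · intro hx
    have hle : tangentCone P u ≤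
        (ConvexCone.hull ℝ ((fun y => y - u) '' P)).toPointedCone hpointed :=
      Submodule.span_le.2 hsub
    obtain ⟨r, hr, _, ⟨y, hy, rfl⟩, rfl⟩ := (ConvexCone.mem_hull_of_convex hconv).1 (hle hx)
    exact ⟨r⁻¹, inv_pos.2 hr, by simpa only [inv_smul_smul₀ hr.ne', add_sub_cancel] using hy⟩
  · rintro ⟨ε, hε, hx⟩
    have h := PointedCone.smul_mem (tangentCone P u) (inv_nonneg.2 hε.le)
      (PointedCone.subset_hull (Set.mem_image_of_mem (fun y => y - u) hx))
    rwa [add_sub_cancel_left, inv_smul_smul₀ hε.ne'] at h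

theorem salient_tangentCone (hP : Convex ℝ P) (hu : u ∈ Set.extremePoints ℝ P) :
    (tangentCone P u : ConvexCone ℝ (Fin d → ℝ)).Salient := by
  intro x hx hx₀ hneg
  obtain ⟨ε, hε, hmem⟩ := (mem_tangentCone hP hu.1).1 hx
  obtain ⟨δ, hδ, hmem'⟩ := (mem_tangentCone hP hu.1).1 hneg
  have hseg : u ∈ openSegment ℝ (u + ε • x) (u + δ • -x) := by
    refine ⟨δ / (ε + δ), ε / (ε + δ), by positivity, by positivity,
      by rw [← add_div, add_comm, div_self (by positivity)], ?_⟩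
    match_scalars <;> field_simp <;> ring
  have heq : u + ε • x = u := hu.2 hmem hmem' hseg
  exact (smul_ne_zero hε.ne' hx₀) (add_eq_left.1 heq)

theorem exists_add_smul_mem_tangentCone (hP : Convex ℝ P) (hu : u ∈ P) (hu' : u + l • w ∈ P)
    (hx : x ∈ tangentCone P (u + l • w)) : ∃ μ : ℝ, x + μ • w ∈ tangentCone P u := by
  obtain ⟨ε, hε, hmem⟩ := (mem_tangentCone hP hu').1 hx
  refine ⟨ε⁻¹ * l, (mem_tangentCone hP hu).2 ⟨ε, hε, ?_⟩⟩
  rwa [smul_add, smul_smul, mul_inv_cancel_left₀ hε.ne', ← add_assoc, add_right_comm]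

theorem neg_mem_tangentCone (hP : Convex ℝ P) (hu : u ∈ P) (hl : 0 < l) (hu' : u + l • w ∈ P) :
    -w ∈ tangentCone P (u + l • w) :=
  (mem_tangentCone hP hu').2 ⟨l, hl, by rwa [smul_neg, add_neg_cancel_right]⟩

theorem neg_mem_primitiveGenerators (hP : Convex ℝ P) (hu : u ∈ P) (hl : 0 < l)
    (hu' : u + l • w ∈ Set.extremePoints ℝ P) (hw : w ∈ primitiveGenerators (tangentCone P u)) :
    -w ∈ primitiveGenerators (tangentCone P (u + l • w)) := by
  obtain ⟨hprim, hface⟩ := mem_primitiveGenerators.1 hw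
  have hneg := neg_mem_tangentCone hP hu hl hu'.1
  refine mem_primitiveGenerators.2 ⟨hprim.neg, .of_mem_of_add_mem_left
    (Submodule.span_le.2 (Set.singleton_subset_iff.2 hneg)) fun {x y} hx hy hxy => ?_⟩
  obtain ⟨c, -, hc⟩ := mem_hull_singleton.1 hxy
  obtain ⟨μ, hxμ⟩ := exists_add_smul_mem_tangentCone hP hu hu'.1 hx
  obtain ⟨ν, hyν⟩ := exists_add_smul_mem_tangentCone hP hu hu'.1 hy
  have hspan : x + μ • w + (y + ν • w) ∈ Submodule.span ℝ {w} := by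
    refine Submodule.mem_span_singleton.2 ⟨-c + μ + ν, ?_⟩
    rw [add_add_add_comm, ← hc]
    module
  obtain ⟨b, -, hb⟩ := mem_hull_singleton.1 (mem_hull_singleton_of_add_mem_span hface hxμ hyν hspan)
  obtain rfl : (b - μ) • w = x := by rw [sub_smul, hb, add_sub_cancel_right]
  have hle : b - μ ≤ 0 := by
    by_contra! hpos
    refine salient_tangentCone hP hu' (-w) hneg (neg_ne_zero.2 hprim.ne_zero) ?_
    have h := PointedCone.smul_mem _ (inv_nonneg.2 hpos.le) hx
    rw [inv_smul_smul₀ hpos.ne'] at h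
    rwa [neg_neg]
  exact mem_hull_singleton.2 ⟨-(b - μ), neg_nonneg.2 hle, neg_smul_neg _ _⟩

end TangentCone

section Polytope

variable {P : Set (Fin d → ℝ)} {u : Fin d → ℝ}

theorem finite_inter_intLattice {S : Set (Fin d → ℝ)} (hS : Bornology.IsBounded S) :
    (S ∩ intLattice d).Finite := by
  obtain ⟨r, hr⟩ := hS.subset_closedBall 0
  refine ((Set.finite_Icc (fun _ : Fin d => -⌈r⌉) (fun _ => ⌈r⌉)).image toReal).subset ?_
  rintro _ ⟨hx, z, rfl⟩
  refine Set.mem_image_of_mem _ (Set.mem_Icc.2 ?_)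
  have h : ∀ i, |(z i : ℝ)| ≤ r := fun i =>
    (norm_le_pi_norm (toReal z) i).trans (mem_closedBall_zero_iff.1 (hr hx))
  have h' : ∀ i, |z i| ≤ ⌈r⌉ := fun i => by exact_mod_cast (h i).trans (Int.le_ceil r)
  exact ⟨fun i => (abs_le.1 (h' i)).1, fun i => (abs_le.1 (h' i)).2⟩

namespace IsLatticePolytope

theorem convex (hP : IsLatticePolytope P) : Convex ℝ P := by
  obtain ⟨V, rfl⟩ := hP
  exact convex_convexHull ℝ _

theorem isCompact (hP : IsLatticePolytope P) : IsCompact P := by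
  obtain ⟨V, rfl⟩ := hP
  exact (V.finite_toSet.image toReal).isCompact_convexHull ℝ

theorem finite_inter_intLattice (hP : IsLatticePolytope P) : (P ∩ intLattice d).Finite :=
  LatticePoly.finite_inter_intLattice hP.isCompact.isBounded

theorem extremePoints_subset_intLattice (hP : IsLatticePolytope P) :
    Set.extremePoints ℝ P ⊆ intLattice d := by
  obtain ⟨V, rfl⟩ := hP
  exact extremePoints_convexHull_subset.trans (Set.image_subset_range _ _)

theorem convexHull_inter_intLattice (hP : IsLatticePolytope P) :
    convexHull ℝ (P ∩ intLattice d) = P := by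
  refine (convexHull_min Set.inter_subset_left hP.convex).antisymm ?_
  obtain ⟨V, rfl⟩ := hP
  exact convexHull_mono (Set.subset_inter (subset_convexHull ℝ _) (Set.image_subset_range _ _))

theorem tangentCone_eq_hull (hP : IsLatticePolytope P) (u : Fin d → ℝ) :
    tangentCone P u = PointedCone.hull ℝ ((fun x => x - u) '' (P ∩ intLattice d)) := by
  refine le_antisymm (Submodule.span_le.2 ?_)
    (Submodule.span_mono (Set.image_mono Set.inter_subset_left))
  rw [Set.image_subset_iff]
  conv_lhs => rw [← hP.convexHull_inter_intLattice]
  refine convexHull_min (Set.image_subset_iff.1 Submodule.subset_span) ?_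
  have h := (PointedCone.convex (PointedCone.hull ℝ ((fun x => x - u) '' (P ∩ intLattice d))))
  simpa only [sub_eq_add_neg] using h.translate_preimage_left (-u)

theorem exists_hull_eq_tangentCone (hP : IsLatticePolytope P) (hu : u ∈ intLattice d) :
    ∃ G ⊆ intLattice d, G.Finite ∧ PointedCone.hull ℝ G = tangentCone P u :=
  ⟨_, Set.image_subset_iff.2 fun _ hx => (intSubgroup d).sub_mem hx.2 hu,
    hP.finite_inter_intLattice.image _, (hP.tangentCone_eq_hull u).symm⟩

end IsLatticePolytope

theorem span_tangentCone (hspan : affineSpan ℝ P = ⊤) (hu : u ∈ P) :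
    Submodule.span ℝ (tangentCone P u : Set (Fin d → ℝ)) = ⊤ := by
  rw [eq_top_iff, ← AffineSubspace.direction_top ℝ (Fin d → ℝ) (Fin d → ℝ), ← hspan,
    direction_affineSpan, vectorSpan_eq_span_vsub_set_right ℝ hu]
  exact Submodule.span_mono PointedCone.subset_hull

theorem salient_normalCone (hspan : affineSpan ℝ P = ⊤) (hu : u ∈ P) :
    (normalCone P u : ConvexCone ℝ (Fin d → ℝ)).Salient := by
  refine fun y hy hy₀ hny => hy₀ (dotProduct_eq_zero _ fun x => ?_)
  have hker : Submodule.span ℝ (tangentCone P u : Set (Fin d → ℝ)) ≤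
      LinearMap.ker (dotProductBilin ℝ ℝ y) := Submodule.span_le.2 fun x hx =>
    le_antisymm (by simpa [dotProduct_comm] using hny hx) (by simpa [dotProduct_comm] using hy hx)
  rw [span_tangentCone hspan hu] at hker
  exact hker (Submodule.mem_top (x := x))

end Polytope

section VertexCones

variable {P : Set (Fin d → ℝ)} {u w : Fin d → ℝ}

namespace IsLatticePolytope

theorem finite_primitiveGenerators_tangentCone (hP : IsLatticePolytope P)
    (hu : u ∈ intLattice d) : (primitiveGenerators (tangentCone P u)).Finite := by
  obtain ⟨G, -, hG, hGu⟩ := hP.exists_hull_eq_tangentCone hu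
  exact hGu ▸ finite_primitiveGenerators_hull hG

theorem hull_primitiveGenerators_tangentCone (hP : IsLatticePolytope P)
    (hu : u ∈ Set.extremePoints ℝ P) :
    PointedCone.hull ℝ (primitiveGenerators (tangentCone P u)) = tangentCone P u := by
  obtain ⟨G, hL, hG, hGu⟩ := hP.exists_hull_eq_tangentCone (hP.extremePoints_subset_intLattice hu)
  exact hGu ▸ hull_primitiveGenerators hG hL (hGu ▸ salient_tangentCone hP.convex hu)

theorem span_primitiveGenerators_tangentCone (hP : IsLatticePolytope P)
    (hspan : affineSpan ℝ P = ⊤) (hu : u ∈ Set.extremePoints ℝ P) :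
    Submodule.span ℝ (primitiveGenerators (tangentCone P u)) = ⊤ := by
  rw [eq_top_iff, ← span_tangentCone hspan hu.1, Submodule.span_le]
  intro x hx
  exact PointedCone.hull_le_span _ _
    ((hP.hull_primitiveGenerators_tangentCone hu).ge hx)

theorem exists_hull_eq_normalCone (hP : IsLatticePolytope P) (hu : u ∈ intLattice d) :
    ∃ F ⊆ intLattice d, F.Finite ∧ PointedCone.hull ℝ F = normalCone P u := by
  obtain ⟨G, hGL, hG, hGu⟩ := hP.exists_hull_eq_tangentCone hu
  obtain ⟨F, hFL, hF, hFG⟩ := exists_hull_eq_dualCone hG hGL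
  exact ⟨F, hFL, hF, by rw [hFG, normalCone, ← hGu, PointedCone.dual_hull]⟩

theorem dualCone_normalCone (hP : IsLatticePolytope P) (hu : u ∈ intLattice d) :
    dualCone (normalCone P u : Set (Fin d → ℝ)) = tangentCone P u := by
  obtain ⟨G, hGL, hG, hGu⟩ := hP.exists_hull_eq_tangentCone hu
  rw [normalCone, ← hGu, PointedCone.dual_hull, dualCone_dualCone hG hGL]

theorem finite_primitiveGenerators_normalCone (hP : IsLatticePolytope P)
    (hu : u ∈ intLattice d) : (primitiveGenerators (normalCone P u)).Finite := by
  obtain ⟨F, -, hF, hFu⟩ := hP.exists_hull_eq_normalCone hu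
  exact hFu ▸ finite_primitiveGenerators_hull hF

theorem dualCone_primitiveGenerators_normalCone (hP : IsLatticePolytope P)
    (hspan : affineSpan ℝ P = ⊤) (hu : u ∈ Set.extremePoints ℝ P) :
    dualCone (primitiveGenerators (normalCone P u)) = tangentCone P u := by
  have huL := hP.extremePoints_subset_intLattice hu
  obtain ⟨F, hFL, hF, hFu⟩ := hP.exists_hull_eq_normalCone huL
  have hgen := hull_primitiveGenerators hF hFL (hFu ▸ salient_normalCone hspan hu.1)
  rw [← PointedCone.dual_hull, ← hFu, hgen, hFu, hP.dualCone_normalCone huL]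

theorem span_primitiveGenerators_normalCone (hP : IsLatticePolytope P)
    (hspan : affineSpan ℝ P = ⊤) (hu : u ∈ Set.extremePoints ℝ P) :
    Submodule.span ℝ (primitiveGenerators (normalCone P u)) = ⊤ := by
  refine span_eq_top_of_forall_dotProduct_eq_zero fun x hx => by_contra fun hx₀ => ?_
  have hdual := hP.dualCone_primitiveGenerators_normalCone hspan hu
  have hpos : x ∈ tangentCone P u := hdual.le fun v hv => (hx v hv).ge
  have hneg : -x ∈ tangentCone P u := hdual.le fun v hv => by simp [hx v hv]
  exact salient_tangentCone hP.convex hu x hpos hx₀ hneg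

theorem detBoundedBy_primitiveGenerators_tangentCone (hP : IsLatticePolytope P)
    (hspan : affineSpan ℝ P = ⊤) (hu : u ∈ Set.extremePoints ℝ P) {m : ℕ}
    (hm : multiplicity (normalCone P u) ≤ m) :
    DetBoundedBy (primitiveGenerators (tangentCone P u)) (d ! * (d ^ d * m) ^ d) := by
  rw [← hP.dualCone_primitiveGenerators_normalCone hspan hu]
  exact (detBoundedBy_of_multiplicity_le hm).primitiveGenerators_dualCone
    (hP.finite_primitiveGenerators_normalCone (hP.extremePoints_subset_intLattice hu))
    (fun v hv => (mem_primitiveGenerators.1 hv).1.mem_intLattice)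
    (hP.span_primitiveGenerators_normalCone hspan hu)

end IsLatticePolytope

theorem exists_add_smul_eq_of_mem_openSegment {a b : Fin d → ℝ} {l : ℝ}
    (hw : (PointedCone.hull ℝ {w}).IsFaceOf (tangentCone P u)) (ha : a ∈ P) (hb : b ∈ P)
    (hab : u + l • w ∈ openSegment ℝ a b) : ∃ s : ℝ, u + s • w = a := by
  obtain ⟨α, β, hα, hβ, hαβ, hsum⟩ := hab
  obtain rfl : β = 1 - α := eq_sub_of_add_eq' hαβ
  have hmem : ∀ {x : Fin d → ℝ} {γ : ℝ}, x ∈ P → 0 < γ → γ • (x - u) ∈ tangentCone P u :=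
    fun hx hγ => PointedCone.smul_mem _ hγ.le (PointedCone.subset_hull (Set.mem_image_of_mem _ hx))
  have hspan : α • (a - u) + (1 - α) • (b - u) ∈ Submodule.span ℝ {w} := by
    refine Submodule.mem_span_singleton.2 ⟨l, ?_⟩
    rw [← add_sub_cancel_left u (l • w), ← hsum]
    module
  obtain ⟨c, -, hc⟩ :=
    mem_hull_singleton.1 (mem_hull_singleton_of_add_mem_span hw (hmem ha hα) (hmem hb hβ) hspan)
  exact ⟨α⁻¹ * c, by rw [mul_smul, hc, inv_smul_smul₀ hα.ne', add_sub_cancel]⟩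

theorem exists_add_smul_mem_extremePoints (hP : Convex ℝ P) (hcompact : IsCompact P)
    (hu : u ∈ P) (hw : w ∈ primitiveGenerators (tangentCone P u)) :
    ∃ l : ℝ, 0 < l ∧ u + l • w ∈ Set.extremePoints ℝ P := by
  obtain ⟨hprim, hface⟩ := mem_primitiveGenerators.1 hw
  obtain ⟨g, -, hg⟩ := hprim.exists_dotProduct_eq_one
  obtain ⟨ε, hε, hεP⟩ := (mem_tangentCone hP hu).1 (mem_of_isFaceOf_hull_singleton hface)
  have hparam : ∀ s : ℝ, g ⬝ᵥ (u + s • w - u) = s := fun s => by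
    rw [add_sub_cancel_left, dotProduct_smul, hg, smul_eq_mul, mul_one]
  have hline : ∀ s : ℝ, u + s • w ∈ {x | u + (g ⬝ᵥ (x - u)) • w = x} := fun s => by
    rw [Set.mem_ofPred_eq, hparam]
  have hclosed : IsClosed {x | u + (g ⬝ᵥ (x - u)) • w = x} :=
    isClosed_eq (by fun_prop) continuous_id
  obtain ⟨x, ⟨hxP, hx⟩, hmax⟩ := (hcompact.inter_right hclosed).exists_isMaxOn
    ⟨_, hεP, hline ε⟩ (f := fun x => g ⬝ᵥ (x - u)) (by fun_prop)
  set l := g ⬝ᵥ (x - u)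
  have hle : ∀ s : ℝ, u + s • w ∈ P → s ≤ l := fun s hs =>
    (hparam s).ge.trans (isMaxOn_iff.1 hmax _ ⟨hs, hline s⟩)
  have hx : u + l • w = x := hx
  refine ⟨l, hε.trans_le (hle ε hεP), hx ▸ hxP, fun a ha b hb hab => ?_⟩
  obtain ⟨s, rfl⟩ := exists_add_smul_eq_of_mem_openSegment hface ha hb hab
  obtain ⟨t, rfl⟩ :=
    exists_add_smul_eq_of_mem_openSegment hface hb ha (by rwa [openSegment_symm])
  obtain ⟨α, β, hα, hβ, hαβ, hsum⟩ := hab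
  obtain rfl : β = 1 - α := eq_sub_of_add_eq' hαβ
  have hst : α * s + (1 - α) * t = l := by
    rw [← hparam l, ← hsum, ← hparam (α * s + (1 - α) * t)]
    congr 2
    module
  have hls : l ≤ s := le_of_mul_le_mul_left (by nlinarith [hle t hb]) hα
  rw [(hle s ha).antisymm hls]

theorem IsLatticePolytope.exists_add_smul_mem_extremePoints (hP : IsLatticePolytope P)
    (hu : u ∈ Set.extremePoints ℝ P) (hw : w ∈ primitiveGenerators (tangentCone P u)) :
    ∃ l : ℝ, 1 ≤ l ∧ u + l • w ∈ Set.extremePoints ℝ P := by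
  obtain ⟨l, hl, hlP⟩ :=
    LatticePoly.exists_add_smul_mem_extremePoints hP.convex hP.isCompact hu.1 hw
  refine ⟨l, ?_, hlP⟩
  have hlw : l • w ∈ intLattice d := by
    have h := (intSubgroup d).sub_mem (hP.extremePoints_subset_intLattice hlP)
      (hP.extremePoints_subset_intLattice hu)
    rwa [add_sub_cancel_left] at h
  simpa only [abs_of_pos hl] using
    one_le_abs_of_int_cast_eq ((mem_primitiveGenerators.1 hw).1.exists_int_cast_eq hlw) hl.ne'

end VertexCones

section Adjacent

variable {𝕜 E : Type*} [Field 𝕜] [LinearOrder 𝕜] [IsStrictOrderedRing 𝕜] [AddCommGroup E]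
  [Module 𝕜 E]

theorem hull_image {F : Type*} [AddCommGroup F] [Module 𝕜 F] (q : E →ₗ[𝕜] F) (G : Set E) :
    PointedCone.hull 𝕜 (q '' G) = (PointedCone.hull 𝕜 G).map q := by
  unfold PointedCone.hull PointedCone.map
  rw [Submodule.map_span]
  rfl

/-- The vectors of `G'` that agree modulo the line `𝕜 v` with a positive multiple of a vector of `G`
off that line. If `G` and `G'` span the edges of a polytope at the two ends of an edge of direction
`v`, these are the edges at the second end that share a `2`-dimensional face with `v`. -/
def adjacent (𝕜 : Type*) {E : Type*} [Field 𝕜] [LinearOrder 𝕜] [AddCommGroup E] [Module 𝕜 E]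
    (G G' : Set E) (v : E) : Set E :=
  {e' ∈ G' | ∃ e ∈ G, e ∉ Submodule.span 𝕜 {v} ∧
    ∃ a : 𝕜, 0 < a ∧ e' - a • e ∈ Submodule.span 𝕜 {v}}

theorem salient_map_mkQ_of_isFaceOf {C : PointedCone 𝕜 E} {v : E}
    (hv : (PointedCone.hull 𝕜 {v}).IsFaceOf C) :
    (C.map (Submodule.span 𝕜 {v}).mkQ : ConvexCone 𝕜 (E ⧸ Submodule.span 𝕜 {v})).Salient := by
  rintro _ ⟨x, hx, rfl⟩ hx₀ ⟨y, hy, hxy⟩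
  refine hx₀ ((Submodule.Quotient.mk_eq_zero _).2 (PointedCone.hull_le_span _ _
    (mem_hull_singleton_of_add_mem_span hv hx hy ((Submodule.Quotient.mk_eq_zero _).1 ?_))))
  have hxy : (Submodule.span 𝕜 {v}).mkQ y = -(Submodule.span 𝕜 {v}).mkQ x := hxy
  exact (map_add (Submodule.mkQ _) x y).trans (by rw [hxy, add_neg_cancel])

theorem span_insert_adjacent {G G' : Set E} {v : E} (hG' : G'.Finite)
    (hv : (PointedCone.hull 𝕜 {v}).IsFaceOf (PointedCone.hull 𝕜 G'))
    (hspan : Submodule.span 𝕜 G' = ⊤)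
    (hmap : (PointedCone.hull 𝕜 G).map (Submodule.span 𝕜 {v}).mkQ =
      (PointedCone.hull 𝕜 G').map (Submodule.span 𝕜 {v}).mkQ) :
    Submodule.span 𝕜 (insert v (adjacent 𝕜 G G' v)) = ⊤ := by
  set q := (Submodule.span 𝕜 {v}).mkQ
  have hq : ∀ {x}, q x = 0 ↔ x ∈ Submodule.span 𝕜 {v} := Submodule.Quotient.mk_eq_zero _
  have hhull : PointedCone.hull 𝕜 (q '' G) = PointedCone.hull 𝕜 (q '' G') := by
    rw [hull_image, hmap, hull_image]
  have hgen := hull_setOf_isFaceOf_hull (hG'.image q)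
    (hull_image q G' ▸ salient_map_mkQ_of_isFaceOf hv)
  have hsub : {g ∈ q '' G' | g ≠ 0 ∧
      (PointedCone.hull 𝕜 {g}).IsFaceOf (PointedCone.hull 𝕜 (q '' G'))} ⊆
      q '' adjacent 𝕜 G G' v := by
    rintro _ ⟨⟨e', he', rfl⟩, he'₀, hface⟩
    obtain ⟨a, ha, e, he, hae⟩ := exists_pos_smul_mem_of_isFaceOf_hull he'₀ (hhull ▸ hface)
    refine ⟨e', ⟨he', e, he, fun h => smul_ne_zero ha.ne' he'₀ (hae.symm.trans (hq.2 h)),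
      a⁻¹, inv_pos.2 ha, hq.1 ?_⟩, rfl⟩
    rw [map_sub, map_smul, hae, inv_smul_smul₀ ha.ne', sub_self]
  have hspan_image : Submodule.span 𝕜 (q '' adjacent 𝕜 G G' v) = ⊤ := by
    rw [eq_top_iff, ← Submodule.range_mkQ (Submodule.span 𝕜 {v}), LinearMap.range_eq_map, ← hspan,
      Submodule.map_span]
    refine Submodule.span_le.2 fun g hg => Submodule.span_mono hsub ?_
    exact PointedCone.hull_le_span _ _ (hgen.ge (PointedCone.subset_hull hg))
  have htop : (Submodule.span 𝕜 (insert v (adjacent 𝕜 G G' v))).map q = ⊤ := by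
    rw [eq_top_iff, ← hspan_image, Submodule.map_span]
    exact Submodule.span_mono (Set.image_mono (Set.subset_insert _ _))
  have hle : Submodule.span 𝕜 {v} ≤ Submodule.span 𝕜 (insert v (adjacent 𝕜 G G' v)) :=
    Submodule.span_mono (Set.singleton_subset_iff.2 (Set.mem_insert v _))
  rwa [LinearMap.map_eq_top_iff (Submodule.range_mkQ _), Submodule.ker_mkQ, sup_eq_left.2 hle]
    at htop

end Adjacent

section AdjacentEdges

variable {P : Set (Fin d → ℝ)} {u w : Fin d → ℝ} {l : ℝ}

theorem map_mkQ_tangentCone (hP : Convex ℝ P) (hu : u ∈ P) (hu' : u + l • w ∈ P) :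
    (tangentCone P u).map (Submodule.span ℝ {w}).mkQ =
      (tangentCone P (u + l • w)).map (Submodule.span ℝ {w}).mkQ := by
  have hle : ∀ {u : Fin d → ℝ} {l : ℝ}, u ∈ P → u + l • w ∈ P →
      (tangentCone P (u + l • w)).map (Submodule.span ℝ {w}).mkQ ≤
        (tangentCone P u).map (Submodule.span ℝ {w}).mkQ := by
    rintro u l hu hu' _ ⟨x, hx, rfl⟩
    obtain ⟨μ, hμ⟩ := exists_add_smul_mem_tangentCone hP hu hu' hx
    refine PointedCone.mem_map.2 ⟨_, hμ, (Submodule.Quotient.eq _).2 ?_⟩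
    rw [add_sub_cancel_left]
    exact Submodule.smul_mem _ _ (Submodule.mem_span_singleton_self w)
  have hback : u + l • w + (-l) • w = u := by rw [neg_smul, add_neg_cancel_right]
  refine le_antisymm ?_ (hle hu hu')
  simpa only [hback] using hle hu' (l := -l) (by rwa [hback])

theorem IsLatticePolytope.span_insert_neg_adjacent (hP : IsLatticePolytope P)
    (hspan : affineSpan ℝ P = ⊤) (hu : u ∈ Set.extremePoints ℝ P) (hl : 0 < l)
    (hu' : u + l • w ∈ Set.extremePoints ℝ P) (hw : w ∈ primitiveGenerators (tangentCone P u)) :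
    Submodule.span ℝ (insert (-w) (adjacent ℝ (primitiveGenerators (tangentCone P u))
      (primitiveGenerators (tangentCone P (u + l • w))) w)) = ⊤ := by
  have hface := (mem_primitiveGenerators.1
    (neg_mem_primitiveGenerators hP.convex hu.1 hl hu' hw)).2
  have hneg : Submodule.span ℝ {-w} = Submodule.span ℝ {w} := by
    rw [← Set.neg_singleton, Submodule.span_neg]
  rw [← hP.hull_primitiveGenerators_tangentCone hu'] at hface
  have hadj : ∀ G G', adjacent ℝ G G' (-w) = adjacent ℝ G G' w := fun G G' => by
    simp only [adjacent, hneg]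
  rw [← hadj]
  refine span_insert_adjacent
    (hP.finite_primitiveGenerators_tangentCone (hP.extremePoints_subset_intLattice hu')) hface
    (hP.span_primitiveGenerators_tangentCone hspan hu') ?_
  rw [hP.hull_primitiveGenerators_tangentCone hu, hP.hull_primitiveGenerators_tangentCone hu']
  have h := map_mkQ_tangentCone hP.convex hu.1 hu'.1
  rwa [← hneg] at h

end AdjacentEdges

section Counting

variable {E : Type*} [AddCommGroup E] [Module ℝ E] {P : Set E} {L : AddSubgroup E}
  {u e₁ e₂ p w : E}

theorem add_smul_add_smul_mem_of_convex (hP : Convex ℝ P) (hu : u ∈ P) (h₁ : u + e₁ ∈ P)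
    (h₂ : u + e₂ ∈ P) {α β : ℝ} (hα : 0 ≤ α) (hβ : 0 ≤ β) (hαβ : α + β ≤ 1) :
    u + (α • e₁ + β • e₂) ∈ P := by
  have h := hP.sum_mem (t := Finset.univ) (w := ![1 - α - β, α, β]) (z := ![u, u + e₁, u + e₂])
    (by simpa [Fin.forall_fin_succ, hα, hβ, sub_sub] using hαβ)
    (by simp only [Fin.sum_univ_three, Matrix.cons_val]; ring)
    (by simp [Fin.forall_fin_succ, hu, h₁, h₂])
  convert h using 1
  simp only [Fin.sum_univ_three, Matrix.cons_val]
  module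

theorem le_ncard_of_add_smul_mem (hP : Convex ℝ P) (hfin : (P ∩ L).Finite) (hw : w ∈ L)
    (hw₀ : w ≠ 0) (hu : u ∈ P ∩ L) {l : ℝ} (hl : 0 ≤ l) (hlP : u + l • w ∈ P) :
    l ≤ (P ∩ L).ncard := by
  have hmaps : ∀ j ∈ Set.Iio (⌊l⌋₊ + 1), u + j • w ∈ P ∩ L := fun j hj => by
    have hjl : (j : ℝ) ≤ l := (Nat.le_floor_iff hl).1 (Nat.lt_succ_iff.1 hj)
    refine ⟨?_, L.add_mem hu.2 (L.nsmul_mem hw j)⟩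
    obtain rfl | hl₀ := hl.eq_or_lt
    · have hj₀ : j = 0 := by exact_mod_cast hjl.antisymm j.cast_nonneg
      simpa [hj₀] using hu.1
    have h := hP.add_smul_mem hu.1 hlP (t := j / l) ⟨by positivity, (div_le_one hl₀).2 hjl⟩
    rwa [smul_smul, div_mul_cancel₀ _ hl₀.ne', Nat.cast_smul_eq_nsmul] at h
  have hinj : Set.InjOn (fun j : ℕ => u + j • w) (Set.Iio (⌊l⌋₊ + 1)) := fun j _ k _ hjk => by
    have h : (j : ℝ) • w = (k : ℝ) • w := by
      simpa only [Nat.cast_smul_eq_nsmul] using add_left_cancel hjk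
    exact_mod_cast smul_left_injective ℝ hw₀ h
  have hcard := Set.ncard_le_ncard_of_injOn _ hmaps hinj hfin
  rw [← Finset.coe_Iio, Set.ncard_coe_finset, Nat.card_Iio] at hcard
  exact (Nat.lt_floor_add_one l).le.trans (by exact_mod_cast hcard)

/- Reducing `j • p` modulo `e₁` gives a lattice point of the parallelogram spanned by `e₁` and
`e₂ = s • e₁ + c • p`; either it or its reflection in the center lies in the triangle. -/
theorem exists_mem_apply_eq_or (hP : Convex ℝ P) (hp : p ∈ L) (hu : u ∈ P ∩ L)
    (h₁ : u + e₁ ∈ P ∩ L) {s c : ℝ} (h₂ : u + (s • e₁ + c • p) ∈ P ∩ L) {f : E →ₗ[ℝ] ℝ}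
    (hf₁ : f e₁ = 0) (hfp : f p = 1) {j : ℕ} (hc : 0 < c) (hjc : (j : ℝ) ≤ c) :
    ∃ x ∈ P ∩ L, f (x - u) = j ∨ f (x - u) = c - j := by
  obtain ⟨e₂, he₂⟩ : ∃ e₂, e₂ = s • e₁ + c • p := ⟨_, rfl⟩
  rw [← he₂] at h₂
  have hmem : ∀ {v : E}, u + v ∈ P ∩ L → v ∈ L := fun h => (L.add_mem_cancel_left hu.2).1 h.2
  set t := j / c * s
  have hα₀ : 0 ≤ ⌈t⌉ - t := sub_nonneg.2 (Int.le_ceil t)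
  have hα₁ : ⌈t⌉ - t < 1 := by linarith [Int.ceil_lt_add_one t]
  have hβ₁ : j / c ≤ 1 := (div_le_one hc).2 hjc
  have hz : (⌈t⌉ - t) • e₁ + (j / c) • e₂ = ⌈t⌉ • e₁ + j • p := by
    rw [he₂, smul_add, smul_smul, smul_smul, div_mul_cancel₀ _ hc.ne', ← add_assoc, ← add_smul,
      sub_add_cancel, Int.cast_smul_eq_zsmul, Nat.cast_smul_eq_nsmul]
  have hzL : ⌈t⌉ • e₁ + j • p ∈ L := L.add_mem (L.zsmul_mem (hmem h₁) _) (L.nsmul_mem hp j)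
  have hfz : f (⌈t⌉ • e₁ + j • p) = j := by simp [hf₁, hfp]
  obtain hle | hlt := le_or_gt (⌈t⌉ - t + j / c) 1
  · refine ⟨_, ⟨add_smul_add_smul_mem_of_convex hP hu.1 h₁.1 h₂.1 hα₀ (by positivity) hle, ?_⟩, ?_⟩
    · exact hz ▸ L.add_mem hu.2 hzL
    · exact .inl (by rw [add_sub_cancel_left, hz, hfz])
  · have hz' : (1 - (⌈t⌉ - t)) • e₁ + (1 - j / c) • e₂ = e₁ + e₂ - (⌈t⌉ • e₁ + j • p) := by
      rw [← hz]
      module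
    refine ⟨_, ⟨add_smul_add_smul_mem_of_convex hP hu.1 h₁.1 h₂.1 (α := 1 - (⌈t⌉ - t))
      (β := 1 - j / c) (by linarith) (by linarith) (by linarith), ?_⟩, .inr ?_⟩
    · exact hz' ▸ L.add_mem hu.2 (L.sub_mem (L.add_mem (hmem h₁) (hmem h₂)) hzL)
    · rw [add_sub_cancel_left, hz', map_sub, hfz, he₂]
      simp [hf₁, hfp]

theorem le_two_mul_ncard (hP : Convex ℝ P) (hfin : (P ∩ L).Finite) (hp : p ∈ L) (hu : u ∈ P ∩ L)
    (h₁ : u + e₁ ∈ P ∩ L) {s c : ℝ} (h₂ : u + (s • e₁ + c • p) ∈ P ∩ L) {f : E →ₗ[ℝ] ℝ}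
    (hf₁ : f e₁ = 0) (hfp : f p = 1) : c ≤ 2 * (P ∩ L).ncard := by
  obtain hc | hc := le_or_gt c 0
  · exact hc.trans (by positivity)
  have hsub : (Nat.cast '' Set.Iio (⌊c / 2⌋₊ + 1) : Set ℝ) ⊆
      (fun x => min (f (x - u)) (c - f (x - u))) '' (P ∩ L) := by
    rintro _ ⟨j, hj, rfl⟩
    have hjc : (j : ℝ) ≤ c / 2 := (Nat.le_floor_iff (by positivity)).1 (Nat.lt_succ_iff.1 hj)
    obtain ⟨x, hx, hfx | hfx⟩ :=
      exists_mem_apply_eq_or hP hp hu h₁ h₂ hf₁ hfp hc (hjc.trans (half_le_self hc.le))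
    · exact ⟨x, hx, by simp only [hfx]; exact min_eq_left (by linarith)⟩
    · exact ⟨x, hx, by simp only [hfx, sub_sub_cancel]; exact min_eq_right (by linarith)⟩
  have hcard := (Set.ncard_le_ncard hsub (hfin.image _)).trans (Set.ncard_image_le hfin)
  rw [Set.ncard_image_of_injective _ Nat.cast_injective, ← Finset.coe_Iio, Set.ncard_coe_finset,
    Nat.card_Iio] at hcard
  have hcard' : ((⌊c / 2⌋₊ + 1 : ℕ) : ℝ) ≤ (P ∩ L).ncard := by exact_mod_cast hcard
  push_cast at hcard'
  linarith [Nat.lt_floor_add_one (c / 2)]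

theorem abs_le_two_mul_ncard (hP : Convex ℝ P) (hfin : (P ∩ L).Finite) (hp : p ∈ L)
    (hu : u ∈ P ∩ L) (h₁ : u + e₁ ∈ P ∩ L) {s c : ℝ} (h₂ : u + (s • e₁ + c • p) ∈ P ∩ L)
    (hpe : p ∉ Submodule.span ℝ {e₁}) : |c| ≤ 2 * (P ∩ L).ncard := by
  obtain ⟨f, hf, hfe⟩ := Submodule.exists_le_ker_of_notMem hpe
  have hfp : ((f p)⁻¹ • f) p = 1 := inv_mul_cancel₀ hf
  have hf₁ : ((f p)⁻¹ • f) e₁ = 0 := by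
    rw [LinearMap.smul_apply, hfe (Submodule.mem_span_singleton_self e₁), smul_zero]
  refine abs_le'.2 ⟨le_two_mul_ncard hP hfin hp hu h₁ h₂ hf₁ hfp, ?_⟩
  refine le_two_mul_ncard hP hfin (L.neg_mem hp) hu h₁ (s := s) ?_ (f := -((f p)⁻¹ • f)) ?_ ?_
  · rwa [neg_smul_neg]
  · rw [LinearMap.neg_apply, hf₁, neg_zero]
  · rw [LinearMap.neg_apply, map_neg, neg_neg, hfp]

end Counting

section AdjacentBounds

variable {E F : Type*} [AddCommGroup E] [Module ℝ E] [SeminormedAddCommGroup F] [NormedSpace ℝ F]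
  {P : Set E} {L : AddSubgroup E} {u e w : E} {l a μ : ℝ}

theorem abs_le_of_adjacent_edges (hP : Convex ℝ P) (hfin : (P ∩ L).Finite) (hw : w ∈ L)
    (he : e ∈ L) (hw₀ : w ≠ 0) (hew : e ∉ Submodule.span ℝ {w}) (hu : u ∈ P ∩ L)
    (hue : u + e ∈ P ∩ L) (hl : 0 < l) (hul : u + l • w ∈ P ∩ L)
    (hule : u + l • w + (a • e + μ • w) ∈ P ∩ L) :
    |a| ≤ 2 * (P ∩ L).ncard ∧ |μ| ≤ 3 * (P ∩ L).ncard := by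
  constructor
  · refine abs_le_two_mul_ncard hP hfin he hu hul (s := 1 + μ / l) ?_ ?_
    · convert hule using 1
      match_scalars <;> field_simp
    · rwa [Submodule.span_singleton_smul_eq hl.ne'.isUnit]
  · have hwe : w ∉ Submodule.span ℝ {e} := fun h => by
      obtain ⟨t, rfl⟩ := Submodule.mem_span_singleton.1 h
      refine hew (Submodule.mem_span_singleton.2 ⟨t⁻¹, inv_smul_smul₀ ?_ e⟩)
      exact (smul_ne_zero_iff.1 hw₀).1
    have hlμ : |l + μ| ≤ 2 * (P ∩ L).ncard := by
      refine abs_le_two_mul_ncard hP hfin hw hu hue (s := a) ?_ hwe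
      convert hule using 1
      module
    have hl' := le_ncard_of_add_smul_mem hP hfin hw hw₀ hu hl.le hul.1
    rw [abs_le] at hlμ ⊢
    constructor <;> linarith

theorem norm_map_le_of_adjacent_edges (hP : Convex ℝ P) (hfin : (P ∩ L).Finite) (hw : w ∈ L)
    (he : e ∈ L) (hw₀ : w ≠ 0) (hew : e ∉ Submodule.span ℝ {w}) (hu : u ∈ P ∩ L)
    (hue : u + e ∈ P ∩ L) (hl : 0 < l) (hul : u + l • w ∈ P ∩ L)
    (hule : u + l • w + (a • e + μ • w) ∈ P ∩ L) (Φ : E →ₗ[ℝ] F) {R : ℝ} (heR : ‖Φ e‖ ≤ R)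
    (hwR : ‖Φ w‖ ≤ R) : ‖Φ (a • e + μ • w)‖ ≤ 5 * (P ∩ L).ncard * R := by
  obtain ⟨ha, hμ⟩ := abs_le_of_adjacent_edges hP hfin hw he hw₀ hew hu hue hl hul hule
  calc ‖Φ (a • e + μ • w)‖ ≤ ‖a • Φ e‖ + ‖μ • Φ w‖ := by
        rw [map_add, map_smul, map_smul]
        exact norm_add_le _ _
    _ = |a| * ‖Φ e‖ + |μ| * ‖Φ w‖ := by
        rw [norm_smul, norm_smul, Real.norm_eq_abs, Real.norm_eq_abs]
    _ ≤ 2 * (P ∩ L).ncard * R + 3 * (P ∩ L).ncard * R := by gcongr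
    _ = 5 * (P ∩ L).ncard * R := by ring

end AdjacentBounds

section EdgeNorms

variable {F : Type*} [SeminormedAddCommGroup F] [NormedSpace ℝ F] (Φ : (Fin d → ℝ) →ₗ[ℝ] F)
  {P : Set (Fin d → ℝ)} {u w x : Fin d → ℝ} {l K R : ℝ}

theorem DetBoundedBy.norm_map_le {E : Set (Fin d → ℝ)} (hK : DetBoundedBy E K)
    (hE : E ⊆ intLattice d) {b : Fin d → Fin d → ℝ} (hb : ∀ i, b i ∈ E)
    (hdet : (Matrix.of b).det ≠ 0) (hR : ∀ i, ‖Φ (b i)‖ ≤ R) (hx : x ∈ E) :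
    ‖Φ x‖ ≤ d * (K * R) := by
  have hdet₁ : 1 ≤ |(Matrix.of b).det| :=
    one_le_abs_of_int_cast_eq (exists_int_cast_eq_det fun i => hE (hb i)) hdet
  calc ‖Φ x‖ ≤ |(Matrix.of b).det| * ‖Φ x‖ := le_mul_of_one_le_left (norm_nonneg _) hdet₁
    _ = ‖∑ i, (Matrix.of (Function.update b i x)).det • Φ (b i)‖ := by
        rw [← Real.norm_eq_abs, ← norm_smul, ← map_smul, ← sum_det_update_smul, map_sum]
        simp only [map_smul]
    _ ≤ ∑ i, |(Matrix.of (Function.update b i x)).det| * ‖Φ (b i)‖ :=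
        (norm_sum_le _ _).trans (Finset.sum_le_sum fun i _ => (norm_smul _ _).le)
    _ ≤ ∑ _i : Fin d, K * R := Finset.sum_le_sum fun i _ =>
        mul_le_mul (hK _ fun j => by rw [Function.update_apply]; split_ifs; exacts [hx, hb j])
          (hR i) (norm_nonneg _) ((abs_nonneg _).trans (hK b hb))
    _ = d * (K * R) := by
        rw [Finset.sum_const, Finset.card_univ, Fintype.card_fin, nsmul_eq_mul]

namespace IsLatticePolytope

theorem add_mem_of_mem_primitiveGenerators (hP : IsLatticePolytope P)
    (hu : u ∈ Set.extremePoints ℝ P) (hw : w ∈ primitiveGenerators (tangentCone P u)) :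
    u + w ∈ P ∩ intLattice d := by
  obtain ⟨l, hl, hlP⟩ := hP.exists_add_smul_mem_extremePoints hu hw
  have hl₀ : 0 < l := one_pos.trans_le hl
  refine ⟨?_, (intSubgroup d).add_mem (hP.extremePoints_subset_intLattice hu)
    (mem_primitiveGenerators.1 hw).1.mem_intLattice⟩
  have h := hP.convex.add_smul_mem hu.1 hlP.1 (t := l⁻¹) ⟨by positivity, inv_le_one_of_one_le₀ hl⟩
  rwa [inv_smul_smul₀ hl₀.ne'] at h

theorem mem_inter_intLattice (hP : IsLatticePolytope P) (hu : u ∈ Set.extremePoints ℝ P) :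
    u ∈ P ∩ intLattice d :=
  ⟨hu.1, hP.extremePoints_subset_intLattice hu⟩

theorem norm_map_le_of_mem_adjacent (hP : IsLatticePolytope P) (hu : u ∈ Set.extremePoints ℝ P)
    (hl : 0 < l) (hu' : u + l • w ∈ Set.extremePoints ℝ P)
    (hw : w ∈ primitiveGenerators (tangentCone P u))
    (hR : ∀ e ∈ primitiveGenerators (tangentCone P u), ‖Φ e‖ ≤ R)
    (hx : x ∈ adjacent ℝ (primitiveGenerators (tangentCone P u))
      (primitiveGenerators (tangentCone P (u + l • w))) w) :
    ‖Φ x‖ ≤ 5 * (P ∩ intLattice d).ncard * R := by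
  obtain ⟨hx, e, he, hew, a, -, hxe⟩ := hx
  obtain ⟨μ, hμ⟩ := Submodule.mem_span_singleton.1 hxe
  obtain rfl : a • e + μ • w = x := by rw [hμ, add_sub_cancel]
  have hprim : ∀ {e}, e ∈ primitiveGenerators (tangentCone P u) → IsPrimitive e :=
    fun he => (mem_primitiveGenerators.1 he).1
  exact norm_map_le_of_adjacent_edges (L := intSubgroup d) hP.convex hP.finite_inter_intLattice
    (hprim hw).mem_intLattice (hprim he).mem_intLattice (hprim hw).ne_zero hew
    (hP.mem_inter_intLattice hu) (hP.add_mem_of_mem_primitiveGenerators hu he) hl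
    (hP.mem_inter_intLattice hu') (hP.add_mem_of_mem_primitiveGenerators hu' hx) Φ (hR e he)
    (hR w hw)

theorem norm_map_le_of_mem_primitiveGenerators (hP : IsLatticePolytope P)
    (hspan : affineSpan ℝ P = ⊤) (hu : u ∈ Set.extremePoints ℝ P) (hl : 0 < l)
    (hu' : u + l • w ∈ Set.extremePoints ℝ P) (hw : w ∈ primitiveGenerators (tangentCone P u))
    (hK : DetBoundedBy (primitiveGenerators (tangentCone P (u + l • w))) K)
    (hR : ∀ e ∈ primitiveGenerators (tangentCone P u), ‖Φ e‖ ≤ R)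
    (hx : x ∈ primitiveGenerators (tangentCone P (u + l • w))) :
    ‖Φ x‖ ≤ d * (K * (5 * (P ∩ intLattice d).ncard * R)) := by
  obtain ⟨b, hb, hdet⟩ := exists_det_ne_zero_of_span_eq_top
    (hP.span_insert_neg_adjacent hspan hu hl hu' hw)
  have hcard : (1 : ℝ) ≤ (P ∩ intLattice d).ncard := by
    exact_mod_cast (Set.ncard_pos hP.finite_inter_intLattice).2 ⟨u, hP.mem_inter_intLattice hu⟩
  refine hK.norm_map_le Φ (fun e he => (mem_primitiveGenerators.1 he).1.mem_intLattice)
    (fun i => ?_) hdet (fun i => ?_) hx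
  · obtain h | h := hb i
    · exact h ▸ neg_mem_primitiveGenerators hP.convex hu.1 hl hu' hw
    · exact h.1
  · obtain h | h := hb i
    · rw [h, map_neg, norm_neg]
      refine (hR w hw).trans (le_mul_of_one_le_left ((norm_nonneg _).trans (hR w hw)) ?_)
      linarith
    · exact hP.norm_map_le_of_mem_adjacent Φ hu hl hu' hw hR h

end IsLatticePolytope

end EdgeNorms

section Propagation

theorem exists_succ_subset_of_finite {α : Type*} {V : Set α} (hV : V.Finite) {A : ℕ → Set α}
    (hA : ∀ k, A k ⊆ V) (hmono : Monotone A) : ∃ k ≤ V.ncard, A (k + 1) ⊆ A k := by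
  by_contra! hcon
  have hcard : ∀ k ≤ V.ncard + 1, k ≤ (A k).ncard := fun k => by
    induction k with
    | zero => exact fun _ => Nat.zero_le _
    | succ k ih =>
      intro hk
      have hlt := Set.ncard_lt_ncard
        ((hmono k.le_succ).ssubset_of_not_subset (hcon k (Nat.le_of_succ_le_succ hk)))
        (hV.subset (hA _))
      exact (ih (k.le_succ.trans hk)).trans_lt hlt
  exact absurd ((hcard _ le_rfl).trans (Set.ncard_le_ncard (hA _) hV)) (Nat.not_succ_le_self _)

variable {F : Type*} [SeminormedAddCommGroup F] [NormedSpace ℝ F] {Φ : (Fin d → ℝ) →ₗ[ℝ] F}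
  {P : Set (Fin d → ℝ)} {u u₀ w : Fin d → ℝ} {l K r : ℝ}

/- A linear functional whose minimum over `A` is not its minimum over `P` decreases along some edge
at its minimizer in `A`, as in the simplex method. -/
theorem IsLatticePolytope.subset_convexHull_of_forall_add_smul_mem (hP : IsLatticePolytope P)
    {A : Set (Fin d → ℝ)} (hA : A ⊆ Set.extremePoints ℝ P) (hne : A.Nonempty)
    (hclosed : ∀ u ∈ A, ∀ w ∈ primitiveGenerators (tangentCone P u), ∀ l : ℝ, 0 < l →
      u + l • w ∈ Set.extremePoints ℝ P → u + l • w ∈ A) : P ⊆ convexHull ℝ A := by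
  intro p hp
  by_contra hpA
  have hfin : A.Finite :=
    hP.finite_inter_intLattice.subset fun u hu => hP.mem_inter_intLattice (hA hu)
  obtain ⟨f, c, hfp, hfA⟩ := geometric_hahn_banach_point_closed (convex_convexHull ℝ A)
    (hfin.isClosed_convexHull ℝ) hpA
  obtain ⟨u, hu, hmin⟩ := A.exists_min_image f hfin hne
  obtain ⟨w, hw, hfw⟩ : ∃ w ∈ primitiveGenerators (tangentCone P u), f w < 0 := by
    by_contra! hall
    have hle : tangentCone P u ≤ (PointedCone.positive ℝ ℝ).comap (f : (Fin d → ℝ) →ₗ[ℝ] ℝ) := by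
      rw [← hP.hull_primitiveGenerators_tangentCone (hA hu)]
      exact Submodule.span_le.2 hall
    have hpu : 0 ≤ f (p - u) := hle (PointedCone.subset_hull (Set.mem_image_of_mem _ hp))
    rw [map_sub] at hpu
    linarith [hfA u (subset_convexHull ℝ A hu)]
  obtain ⟨l, hl, hul⟩ := hP.exists_add_smul_mem_extremePoints (hA hu) hw
  have hl₀ : 0 < l := one_pos.trans_le hl
  have hle := hmin _ (hclosed u hu w hw l hl₀ hul)
  rw [map_add, map_smul, smul_eq_mul] at hle
  linarith [mul_neg_of_pos_of_neg hl₀ hfw]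

/-- The vertices `u` of `P` such that, after applying `Φ`, both `u - u₀` and the primitive edge
vectors at `u` have norm at most `r`. -/
def boundedVertices (Φ : (Fin d → ℝ) →ₗ[ℝ] F) (P : Set (Fin d → ℝ)) (u₀ : Fin d → ℝ) (r : ℝ) :
    Set (Fin d → ℝ) :=
  {u ∈ Set.extremePoints ℝ P | ‖Φ (u - u₀)‖ ≤ r ∧
    ∀ e ∈ primitiveGenerators (tangentCone P u), ‖Φ e‖ ≤ r}

theorem boundedVertices_mono : Monotone (boundedVertices Φ P u₀) :=
  fun _ _ h _ hu => ⟨hu.1, hu.2.1.trans h, fun e he => (hu.2.2 e he).trans h⟩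

namespace IsLatticePolytope

theorem add_smul_mem_boundedVertices (hP : IsLatticePolytope P) (hspan : affineSpan ℝ P = ⊤)
    (hu : u ∈ boundedVertices Φ P u₀ r) (hw : w ∈ primitiveGenerators (tangentCone P u))
    (hl : 0 < l) (hu' : u + l • w ∈ Set.extremePoints ℝ P)
    (hK : DetBoundedBy (primitiveGenerators (tangentCone P (u + l • w))) K) :
    u + l • w ∈ boundedVertices Φ P u₀
      ((1 + (P ∩ intLattice d).ncard + d * (K * (5 * (P ∩ intLattice d).ncard))) * r) := by
  obtain ⟨hu, hur, her⟩ := hu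
  have hr : 0 ≤ r := (norm_nonneg _).trans hur
  have hK₀ : 0 ≤ K := hK.nonneg (hP.span_primitiveGenerators_tangentCone hspan hu')
  have hprim := (mem_primitiveGenerators.1 hw).1
  have hln : l ≤ (P ∩ intLattice d).ncard :=
    le_ncard_of_add_smul_mem (L := intSubgroup d) hP.convex hP.finite_inter_intLattice
      hprim.mem_intLattice hprim.ne_zero (hP.mem_inter_intLattice hu) hl.le hu'.1
  have hstep : 0 ≤ d * (K * (5 * (P ∩ intLattice d).ncard)) * r := by positivity
  refine ⟨hu', ?_, fun e he => ?_⟩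
  · calc ‖Φ (u + l • w - u₀)‖ ≤ ‖Φ (u - u₀)‖ + ‖l • Φ w‖ := by
          rw [add_sub_right_comm, map_add, map_smul]
          exact norm_add_le _ _
      _ ≤ r + (P ∩ intLattice d).ncard * r := by
          rw [norm_smul, Real.norm_of_nonneg hl.le]
          gcongr
          exact her w hw
      _ ≤ _ := by linarith
  · have hnr : 0 ≤ (P ∩ intLattice d).ncard * r := by positivity
    have h := hP.norm_map_le_of_mem_primitiveGenerators Φ hspan hu hl hu' hw hK her he
    linarith

theorem norm_map_sub_le (hP : IsLatticePolytope P) (hspan : affineSpan ℝ P = ⊤)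
    (hK : ∀ u ∈ Set.extremePoints ℝ P, DetBoundedBy (primitiveGenerators (tangentCone P u)) K)
    (hu₀ : u₀ ∈ boundedVertices Φ P u₀ r) {x : Fin d → ℝ} (hx : x ∈ P) :
    ‖Φ (x - u₀)‖ ≤ (1 + (P ∩ intLattice d).ncard + d * (K * (5 * (P ∩ intLattice d).ncard))) ^
      (P ∩ intLattice d).ncard * r := by
  set n := (P ∩ intLattice d).ncard
  set c := 1 + n + d * (K * (5 * n))
  have hK₀ : 0 ≤ K := (hK u₀ hu₀.1).nonneg (hP.span_primitiveGenerators_tangentCone hspan hu₀.1)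
  have hr : 0 ≤ r := (norm_nonneg _).trans hu₀.2.1
  have hc : 1 ≤ c :=
    le_add_of_le_of_nonneg (le_add_of_nonneg_right n.cast_nonneg) (by positivity)
  have hmono : Monotone fun k : ℕ => c ^ k * r := fun j k hjk => by
    beta_reduce
    gcongr
  obtain ⟨k, hk, hstable⟩ := exists_succ_subset_of_finite hP.finite_inter_intLattice
    (fun k u hu => hP.mem_inter_intLattice hu.1) ((boundedVertices_mono (Φ := Φ)).comp hmono)
  have hsub := hP.subset_convexHull_of_forall_add_smul_mem
    (A := boundedVertices Φ P u₀ (c ^ k * r)) (fun u hu => hu.1)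
    ⟨u₀, boundedVertices_mono (by simpa using hmono k.zero_le) hu₀⟩ fun u hu w hw l hl hu' =>
      hstable (by
        have h := hP.add_smul_mem_boundedVertices hspan hu hw hl hu' (hK _ hu')
        rwa [← mul_assoc, ← pow_succ'] at h)
  have hball : convexHull ℝ (boundedVertices Φ P u₀ (c ^ k * r)) ⊆
      Φ ⁻¹' Metric.closedBall (Φ u₀) (c ^ k * r) := by
    refine convexHull_min (fun u hu => ?_) ((convex_closedBall _ _).linear_preimage Φ)
    rw [Set.mem_preimage, mem_closedBall_iff_norm, ← map_sub]
    exact hu.2.1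
  have h := hball (hsub hx)
  rw [Set.mem_preimage, mem_closedBall_iff_norm, ← map_sub] at h
  exact h.trans (hmono hk)

end IsLatticePolytope

end Propagation

section Codes

variable {P P' : Set (Fin d → ℝ)} {Φ Φ' Ψ : (Fin d → ℝ) ≃ₗ[ℝ] (Fin d → ℝ)}
  {u u' x : Fin d → ℝ}

/-- The lattice `Φ(ℤ^d)`: the lattice `ℤ^d` in the coordinates given by `Φ`. -/
def imageLattice (Φ : (Fin d → ℝ) ≃ₗ[ℝ] (Fin d → ℝ)) : AddSubgroup (Fin d → ℝ) :=
  (intSubgroup d).map Φ.toLinearMap.toAddMonoidHom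

theorem mem_imageLattice : x ∈ imageLattice Φ ↔ ∃ y ∈ intLattice d, Φ y = x :=
  Iff.rfl

theorem integrallyEquivalent_of_imageLattice_eq (hP : IsLatticePolytope P)
    (hP' : IsLatticePolytope P') (hspan : affineSpan ℝ P = ⊤) (hspan' : affineSpan ℝ P' = ⊤)
    (hΨ : imageLattice Ψ = intSubgroup d) (hu : u ∈ intLattice d) (hu' : u' ∈ intLattice d)
    (himage : (fun x => Ψ (x - u) + u') '' (P ∩ intLattice d) = P' ∩ intLattice d) :
    IntegrallyEquivalent P P' := by
  let f : (Fin d → ℝ) →ᵃ[ℝ] (Fin d → ℝ) :=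
    (Ψ : (Fin d → ℝ) →ₗ[ℝ] (Fin d → ℝ)).toAffineMap + AffineMap.const ℝ _ (u' - Ψ u)
  have hf : ⇑f = fun x => Ψ (x - u) + u' := funext fun x => by
    change Ψ x + (u' - Ψ u) = _
    rw [map_sub]
    abel
  refine ⟨f, ?_, ?_⟩
  · rw [hspan, hspan', AffineSubspace.top_coe, Set.inter_univ, hf]
    refine ⟨fun x hx => ?_, fun x _ y _ hxy => ?_, fun y hy => ?_⟩
    · have hmem : Ψ (x - u) ∈ intSubgroup d :=
        hΨ.le (mem_imageLattice.2 ⟨_, (intSubgroup d).sub_mem hx hu, rfl⟩)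
      exact (intSubgroup d).add_mem hmem hu'
    · exact sub_left_injective (Ψ.injective (add_right_cancel hxy))
    · obtain ⟨x, hx, hxy⟩ := mem_imageLattice.1 (hΨ.ge ((intSubgroup d).sub_mem hy hu'))
      refine ⟨x + u, (intSubgroup d).add_mem hx hu, ?_⟩
      simp only [add_sub_cancel_right, hxy, sub_add_cancel]
  · rw [← hP.convexHull_inter_intLattice, AffineMap.image_convexHull, hf, himage,
      hP'.convexHull_inter_intLattice]

theorem le_of_inter_closedBall_subset {Λ Λ' : AddSubgroup (Fin d → ℝ)} (hΛ : intSubgroup d ≤ Λ)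
    (hΛ' : intSubgroup d ≤ Λ')
    (h : (Λ : Set (Fin d → ℝ)) ∩ Metric.closedBall 0 1 ⊆ Λ') : Λ ≤ Λ' := by
  intro x hx
  have hfloor : toReal (fun i => ⌊x i⌋) ∈ intSubgroup d := ⟨_, rfl⟩
  have hball : x - toReal (fun i => ⌊x i⌋) ∈ Metric.closedBall 0 1 := by
    rw [mem_closedBall_zero_iff, pi_norm_le_iff_of_nonneg zero_le_one]
    intro i
    have hfract : (x - toReal (fun i => ⌊x i⌋)) i = Int.fract (x i) := rfl
    rw [hfract, Real.norm_of_nonneg (Int.fract_nonneg _)]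
    exact (Int.fract_lt_one _).le
  simpa only [sub_add_cancel] using
    Λ'.add_mem (h ⟨Λ.sub_mem hx (hΛ hfloor), hball⟩) (hΛ' hfloor)

/-- The lattice `Φ(ℤ^d)`, truncated to the unit ball, together with the lattice points of `P` in the
coordinates `x ↦ Φ (x - u)`. When `Φ(ℤ^d)` contains `ℤ^d` the truncation loses no information, so
that `P` can be recovered up to integral equivalence. -/
def latticeCode (Φ : (Fin d → ℝ) ≃ₗ[ℝ] (Fin d → ℝ)) (u : Fin d → ℝ) (P : Set (Fin d → ℝ)) :
    Set (Fin d → ℝ) × Set (Fin d → ℝ) :=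
  (imageLattice Φ ∩ Metric.closedBall 0 1, (fun x => Φ (x - u)) '' (P ∩ intLattice d))

theorem integrallyEquivalent_of_latticeCode_eq (hP : IsLatticePolytope P)
    (hP' : IsLatticePolytope P') (hspan : affineSpan ℝ P = ⊤) (hspan' : affineSpan ℝ P' = ⊤)
    (hΦ : intSubgroup d ≤ imageLattice Φ) (hΦ' : intSubgroup d ≤ imageLattice Φ')
    (hu : u ∈ intLattice d) (hu' : u' ∈ intLattice d)
    (h : latticeCode Φ u P = latticeCode Φ' u' P') : IntegrallyEquivalent P P' := by
  obtain ⟨hlattice, hpoints⟩ := Prod.ext_iff.1 h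
  have hmap : imageLattice Φ = imageLattice Φ' :=
    le_antisymm (le_of_inter_closedBall_subset hΦ hΦ' (hlattice.subset.trans Set.inter_subset_left))
      (le_of_inter_closedBall_subset hΦ' hΦ (hlattice.superset.trans Set.inter_subset_left))
  refine integrallyEquivalent_of_imageLattice_eq (Ψ := Φ.trans Φ'.symm) hP hP' hspan hspan' ?_
    hu hu' ?_
  · ext x
    rw [mem_imageLattice]
    constructor
    · rintro ⟨y, hy, rfl⟩
      obtain ⟨z, hz, hzy⟩ := mem_imageLattice.1 (hmap.le (mem_imageLattice.2 ⟨y, hy, rfl⟩))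
      rwa [LinearEquiv.trans_apply, ← hzy, LinearEquiv.symm_apply_apply]
    · intro hx
      obtain ⟨y, hy, hyx⟩ := mem_imageLattice.1 (hmap.ge (mem_imageLattice.2 ⟨x, hx, rfl⟩))
      exact ⟨y, hy, by rw [LinearEquiv.trans_apply, hyx, LinearEquiv.symm_apply_apply]⟩
  · have himage := congrArg (fun S => (fun y => Φ'.symm y + u') '' S) hpoints
    simpa only [latticeCode, Set.image_image, LinearEquiv.trans_apply,
      LinearEquiv.symm_apply_apply, sub_add_cancel, Set.image_id'] using himage

/-- The vectors of norm at most `ρ` with coordinates in `(1 / q) ℤ`. -/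
def boundedFractions (d : ℕ) (ρ : ℝ) (q : ℕ) : Set (Fin d → ℝ) :=
  {x | ‖x‖ ≤ ρ ∧ q • x ∈ intLattice d}

theorem finite_boundedFractions (ρ : ℝ) {q : ℕ} (hq : q ≠ 0) :
    (boundedFractions d ρ q).Finite := by
  refine ((finite_inter_intLattice (Metric.isBounded_closedBall (x := 0) (r := q * ρ))).preimage
    (smul_right_injective _ hq).injOn).subset fun x hx => ⟨?_, hx.2⟩
  beta_reduce
  rw [mem_closedBall_zero_iff, ← Nat.cast_smul_eq_nsmul ℝ, norm_smul, RCLike.norm_natCast]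
  gcongr
  exact hx.1

theorem latticeCode_mem_powerset_boundedFractions {ρ : ℝ} {q : ℕ}
    (hq : ∀ x ∈ intLattice d, q • Φ x ∈ intLattice d) (hu : u ∈ intLattice d)
    (hρ : ∀ x ∈ P, ‖Φ (x - u)‖ ≤ ρ) :
    latticeCode Φ u P ∈ (boundedFractions d 1 q).powerset ×ˢ (boundedFractions d ρ q).powerset := by
  constructor
  · rintro _ ⟨⟨x, hx, rfl⟩, hball⟩
    exact ⟨mem_closedBall_zero_iff.1 hball, hq x hx⟩
  · rintro _ ⟨x, hx, rfl⟩
    exact ⟨hρ x hx.1, hq _ ((intSubgroup d).sub_mem hx.2 hu)⟩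

end Codes

section Charts

open Module

variable {B : Basis (Fin d) ℝ (Fin d → ℝ)} {x : Fin d → ℝ}

theorem intSubgroup_le_imageLattice_equivFun (hB : ∀ i, B i ∈ intLattice d) :
    intSubgroup d ≤ imageLattice B.equivFun := by
  rintro _ ⟨z, rfl⟩
  refine ⟨∑ i, z i • B i, (intSubgroup d).sum_mem fun i _ => (intSubgroup d).zsmul_mem (hB i) _,
    B.equivFun.symm.injective ?_⟩
  change B.equivFun.symm (B.equivFun _) = _
  rw [LinearEquiv.symm_apply_apply, B.equivFun_symm_apply]
  exact Finset.sum_congr rfl fun i _ => (Int.cast_smul_eq_zsmul ℝ _ _).symm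

theorem det_smul_equivFun (x : Fin d → ℝ) :
    (Matrix.of B).det • B.equivFun x = fun i => (Matrix.of (Function.update B i x)).det := by
  apply B.equivFun.symm.injective
  rw [map_smul, LinearEquiv.symm_apply_apply, B.equivFun_symm_apply, sum_det_update_smul]

theorem factorial_nsmul_equivFun_mem (hB : ∀ i, B i ∈ intLattice d) {K : ℕ}
    (hK : |(Matrix.of B).det| ≤ K) (hx : x ∈ intLattice d) : K ! • B.equivFun x ∈ intLattice d := by
  obtain ⟨D, hD⟩ := exists_int_cast_eq_det hB
  have hdet : (Matrix.of B).det ≠ 0 := ((Matrix.isUnit_iff_isUnit_det _).1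
    (Matrix.linearIndependent_rows_iff_isUnit.1 B.linearIndependent)).ne_zero
  have hDK : D.natAbs ≤ K := by
    rw [← hD, ← Int.cast_abs, Int.abs_eq_natAbs] at hK
    exact_mod_cast hK
  obtain ⟨k, hk⟩ : D ∣ (K ! : ℤ) := Int.natAbs_dvd.1 <| Int.natCast_dvd_natCast.2 <|
    Nat.dvd_factorial (Int.natAbs_pos.2 fun h => hdet (by rw [← hD, h, Int.cast_zero])) hDK
  have hmem : (Matrix.of B).det • B.equivFun x ∈ intLattice d := by
    rw [det_smul_equivFun, mem_intLattice]
    refine fun i => exists_int_cast_eq_det fun j => ?_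
    rw [Function.update_apply]
    split_ifs
    exacts [hx, hB j]
  rw [← natCast_zsmul, hk, mul_comm, mul_smul, ← Int.cast_smul_eq_zsmul ℝ D, hD]
  exact (intSubgroup d).zsmul_mem hmem k

end Charts

section Finiteness

open Module

variable {P : Set (Fin d → ℝ)} {m n N : ℕ}

theorem IsLatticePolytope.exists_basis_mem_boundedVertices (hP : IsLatticePolytope P)
    (hspan : affineSpan ℝ P = ⊤) {u : Fin d → ℝ} (hu : u ∈ Set.extremePoints ℝ P) {K : ℝ}
    (hK : DetBoundedBy (primitiveGenerators (tangentCone P u)) K) :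
    ∃ B : Basis (Fin d) ℝ (Fin d → ℝ), (∀ i, B i ∈ primitiveGenerators (tangentCone P u)) ∧
      u ∈ boundedVertices (B.equivFun : (Fin d → ℝ) →ₗ[ℝ] (Fin d → ℝ)) P u (d * K) := by
  obtain ⟨b, hb, hdet⟩ :=
    exists_det_ne_zero_of_span_eq_top (hP.span_primitiveGenerators_tangentCone hspan hu)
  obtain ⟨B, rfl⟩ : ∃ B : Basis (Fin d) ℝ (Fin d → ℝ), ⇑B = b := by
    classical
    exact ⟨_, coe_basisOfPiSpaceOfLinearIndependent <| Matrix.linearIndependent_rows_iff_isUnit.2 <|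
      (Matrix.isUnit_iff_isUnit_det _).2 hdet.isUnit⟩
  have hnorm : ∀ i, ‖B.equivFun (B i)‖ ≤ 1 := fun i => by
    refine (pi_norm_le_iff_of_nonneg zero_le_one).2 fun j => ?_
    rw [B.equivFun_self]
    split_ifs <;> simp
  refine ⟨B, hb, hu, ?_, fun e he => ?_⟩
  · rw [sub_self, map_zero, norm_zero]
    exact mul_nonneg d.cast_nonneg ((abs_nonneg _).trans (hK B hb))
  · simpa only [mul_one] using hK.norm_map_le (B.equivFun : (Fin d → ℝ) →ₗ[ℝ] (Fin d → ℝ))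
      (fun e he => (mem_primitiveGenerators.1 he).1.mem_intLattice) hb hdet hnorm he

/-- The lattice `d`-polytopes in `ℝ^d` with at most `n` lattice points whose normal cones at the
vertices have multiplicity at most `m`. -/
def boundedMultiplicityPolytopes (d m n : ℕ) : Set (Set (Fin d → ℝ)) :=
  {P | IsLatticePolytope P ∧ affineSpan ℝ P = ⊤ ∧ (P ∩ intLattice d).ncard ≤ n ∧
    ∀ u ∈ Set.extremePoints ℝ P, multiplicity (normalCone P u) ≤ (m : ℝ≥0∞)}

theorem boundedGorensteinPolytopes_subset :
    boundedGorensteinPolytopes d m N ⊆ boundedMultiplicityPolytopes d m (N + 1) :=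
  fun _ ⟨hP, hspan, hcard, hm⟩ => ⟨hP, hspan, hcard.le, fun u hu => (hm u hu).2⟩

theorem exists_latticeCode_mem_powerset_boundedFractions (d m n : ℕ) :
    ∃ (ρ : ℝ) (q : ℕ), q ≠ 0 ∧ ∀ P ∈ boundedMultiplicityPolytopes d m n,
      ∃ u ∈ intLattice d, ∃ Φ : (Fin d → ℝ) ≃ₗ[ℝ] (Fin d → ℝ), intSubgroup d ≤ imageLattice Φ ∧
        latticeCode Φ u P ∈
          (boundedFractions d 1 q).powerset ×ˢ (boundedFractions d ρ q).powerset := by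
  set K : ℕ := d ! * (d ^ d * m) ^ d with hK
  refine ⟨(1 + n + d * (K * (5 * n))) ^ n * (d * K), K !, K.factorial_ne_zero,
    fun P ⟨hP, hspan, hcard, hm⟩ => ?_⟩
  have hdet : ∀ u ∈ Set.extremePoints ℝ P,
      DetBoundedBy (primitiveGenerators (tangentCone P u)) K := fun u hu => by
    simpa [hK] using hP.detBoundedBy_primitiveGenerators_tangentCone hspan hu (hm u hu)
  obtain ⟨u, hu⟩ := hP.isCompact.extremePoints_nonempty
    (AffineSubspace.nonempty_of_affineSpan_eq_top _ _ _ hspan)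
  obtain ⟨B, hB, huB⟩ := hP.exists_basis_mem_boundedVertices hspan hu (hdet u hu)
  have hBL : ∀ i, B i ∈ intLattice d :=
    fun i => (mem_primitiveGenerators.1 (hB i)).1.mem_intLattice
  have huL := hP.extremePoints_subset_intLattice hu
  refine ⟨u, huL, B.equivFun, intSubgroup_le_imageLattice_equivFun hBL,
    latticeCode_mem_powerset_boundedFractions
      (fun x => factorial_nsmul_equivFun_mem hBL (hdet u hu B hB)) huL fun x hx => ?_⟩
  have hcard' : ((P ∩ intLattice d).ncard : ℝ) ≤ n := by exact_mod_cast hcard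
  refine (hP.norm_map_sub_le hspan hdet huB hx).trans ?_
  refine mul_le_mul_of_nonneg_right ?_ (by positivity)
  exact (pow_le_pow_left₀ (by positivity) (by gcongr) _).trans <| pow_le_pow_right₀
    (le_add_of_le_of_nonneg (le_add_of_nonneg_right n.cast_nonneg) (by positivity)) hcard

end Finiteness

end LatticePoly

open LatticePoly in
theorem mainTheorem5_general {d m n : ℕ} {S : Set (Set (Fin d → ℝ))}
    (hS : S ⊆ boundedMultiplicityPolytopes d m n) :
    ∃ T : Set (Set (Fin d → ℝ)), T.Finite ∧ T ⊆ S ∧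
      ∀ P ∈ S, ∃ Q ∈ T, IntegrallyEquivalent P Q := by
  obtain ⟨ρ, q, hq, hcode⟩ := exists_latticeCode_mem_powerset_boundedFractions d m n
  choose! u hu Φ hΦ hcode using hcode
  have hfin : ((fun P => latticeCode (Φ P) (u P) P) '' S).Finite :=
    ((finite_boundedFractions 1 hq).powerset.prod (finite_boundedFractions ρ hq).powerset).subset
      (Set.image_subset_iff.2 fun P hP => hcode P (hS hP))
  obtain ⟨T, hTS, hT⟩ := Set.exists_subset_bijOn S fun P => latticeCode (Φ P) (u P) P
  refine ⟨T, hT.finite_iff_finite.2 hfin, hTS, fun P hP => ?_⟩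
  obtain ⟨Q, hQ, hQP⟩ := hT.surjOn ⟨P, hP, rfl⟩
  have hP' := hS hP
  have hQ' := hS (hTS hQ)
  exact ⟨Q, hQ, integrallyEquivalent_of_latticeCode_eq hP'.1 hQ'.1 hP'.2.1 hQ'.2.1 (hΦ P hP')
    (hΦ Q hQ') (hu P hP') (hu Q hQ') hQP.symm⟩

theorem mainTheorem5 (d m N : ℕ) :
    ∃ S : Set (Set (Fin d → ℝ)), S.Finite ∧ S ⊆ LatticePoly.boundedGorensteinPolytopes d m N ∧
      ∀ P ∈ LatticePoly.boundedGorensteinPolytopes d m N,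
        ∃ Q ∈ S, LatticePoly.IntegrallyEquivalent P Q :=
  mainTheorem5_general LatticePoly.boundedGorensteinPolytopes_subset
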